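/- Let $n\ge 2$, let $t_0<t_1<\dots<t_{n+1}$ be real numbers, and let $C=C(n+2,3)\subset\mathbb{R}^3$ be the cyclic polytope that is the convex hull of the points $p_i=(t_i,t_i^2,t_i^3)$, $0\le i\le n+1$. For $S\subseteq\{0,\dots,n+1\}$ write $\operatorname{conv}(S)$ for the convex hull of $\{p_i : i\in S\}$. A *triangulation* of $C$ is a collection $T$ of four-element subsets of $\{0,\dots,n+1\}$ (tetrahedra) such that $\bigcup_{S\in T}\operatorname{conv}(S)=C$ and any two $S,S'\in T$ intersect in a common (possibly empty) face, i.e. $\operatorname{conv}(S)\cap\operatorname{conv}(S')=\operatorname{conv}(S\cap S')$. A graph $G=([n],E)$ on $[n]=\{1,\dots,n\}$ is *persistent* if 1. $\{i,i+1\}\in E$ for all $1\le i<n$; 2. whenever $a<b<c<d$ and $\{a,c\},\{b,d\}\in E$, then $\{a,d\}\in E$; 3. for every edge $\{a,b\}\in E$ with $a<b-1$ there is a vertex $x$ with $a<x<b$ and $\{a,x\},\{x,b\}\in E$. For a triangulation $T$ of $C$, let $\Gamma(T)$ be the graph on $[n]$ in which distinct $i,j\in[n]$ are adjacent if and only if $\{i,j\}\subseteq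 S$ for some $S\in T$. For a persistent graph $G=([n],E)$, let $\hat G$ be the graph on $\{0,\dots,n+1\}$ obtained from $G$ by adding the vertices $0$ and $n+1$, each joined to all other vertices. For an edge $e=\{v,w\}\in E$ with $v<w$, let $\ell_G(e)$ be the largest $i<v$ adjacent to $w$ in $\hat G$, and let $r_G(e)$ be the smallest $i>w$ adjacent to $v$ in $\hat G$. Let $$\Xi(G)=\bigl\{\{\ell_G(e),v,w,r_G(e)\} : e=\{v,w\}\in E,\ v<w\bigr\}.$$ Then $\Gamma(T)$ is a persistent graph for every triangulation $T$ of $C$, and $\Xi(G)$ is a triangulation of $C$ for every persistent graph $G$ on $[n]$. Moreover $\Xi(\Gamma(T))=T$ for every triangulation $T$ of $C$ and $\Gamma(\Xi(G))=G$ for every persistent graph $G$ on $[n]$. Hence $\Gamma$ and $\Xi$ are mutually inverse bijections between the set of triangulations of $C(n+2,3)$ and the set of persistent graphs on $[n]$. -/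

import Mathlib

/-- The moment curve `s ↦ (s, s ^ 2, …, s ^ d)` in `ℝ ^ d`. -/
def momentCurve (d : ℕ) (s : ℝ) : Fin d → ℝ := fun k => s ^ ((k : ℕ) + 1)

/-- The convex hull in `ℝ ^ 3` of the points of the moment curve at the parameters `t i`, for `i` in
the set `S` of labels. -/
def momentHull {m : ℕ} (t : Fin m → ℝ) (S : Set (Fin m)) : Set (Fin 3 → ℝ) :=
  convexHull ℝ ((fun i => momentCurve 3 (t i)) '' S)

/-- The cyclic polytope `C(m, 3)` with vertices on the moment curve at the parameters `t i`. -/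
def cyclicPolytope3 {m : ℕ} (t : Fin m → ℝ) : Set (Fin 3 → ℝ) :=
  momentHull t Set.univ

/-- A triangulation of the cyclic polytope `C(m, 3)`: a collection of combinatorial tetrahedra
(four-element vertex sets) whose convex hulls cover the polytope and meet pairwise in a common,
possibly empty, face. For tetrahedra, the common face is spanned by the common vertices. -/
structure IsCyclicTriangulation {m : ℕ} (t : Fin m → ℝ) (T : Set (Finset (Fin m))) : Prop where
  card_eq : ∀ S ∈ T, S.card = 4
  cover : ⋃ S ∈ T, momentHull t (S : Set (Fin m)) = cyclicPolytope3 t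
  inter : ∀ S ∈ T, ∀ S' ∈ T,
    momentHull t (S : Set (Fin m)) ∩ momentHull t (S' : Set (Fin m)) =
      momentHull t ((S : Set (Fin m)) ∩ (S' : Set (Fin m)))

/-- The set of all triangulations of the cyclic polytope with parameters `t`. -/
def cyclicTriangulations {m : ℕ} (t : Fin m → ℝ) : Set (Set (Finset (Fin m))) :=
  {T | IsCyclicTriangulation t T}

/-- Persistent graphs; the vertices `1, …, n` are represented in their order by the elements
`0, …, n - 1` of `Fin n`. -/
structure IsPersistent {n : ℕ} (G : SimpleGraph (Fin n)) : Prop where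
  hamilton : ∀ i j : Fin n, (i : ℕ) + 1 = (j : ℕ) → G.Adj i j
  xProperty : ∀ a b c d : Fin n, a < b → b < c → c < d → G.Adj a c → G.Adj b d → G.Adj a d
  barProperty : ∀ a b : Fin n, G.Adj a b → (a : ℕ) + 1 < (b : ℕ) →
    ∃ x : Fin n, a < x ∧ x < b ∧ G.Adj a x ∧ G.Adj x b

/-- The set of all persistent graphs with `n` vertices. -/
def persistentGraphs (n : ℕ) : Set (SimpleGraph (Fin n)) :=
  {G | IsPersistent G}

/-- The position of a graph vertex among `0, …, n + 1`: the element `i` of `Fin n` is sent to the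
vertex `i + 1`, so that the image consists of all vertices but `0` and `n + 1`. -/
def innerVertex {n : ℕ} (i : Fin n) : Fin (n + 2) := i.castSucc.succ

/-- The graph `Γ(T)`: two different inner vertices are adjacent if and only if some tetrahedron
of `T` contains both. -/
def GammaMap {n : ℕ} (T : Set (Finset (Fin (n + 2)))) : SimpleGraph (Fin n) where
  Adj i j := i ≠ j ∧ ∃ S ∈ T, innerVertex i ∈ S ∧ innerVertex j ∈ S
  symm := ⟨fun _ _ ⟨hne, S, hS, hi, hj⟩ => ⟨hne.symm, S, hS, hj, hi⟩⟩
  loopless := ⟨fun _ h => h.1 rfl⟩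

/-- The graph `Ĝ` on `0, …, n + 1`: the graph `G` on the inner vertices, with `0` and `n + 1` joined
to all other vertices. -/
def hatGraph {n : ℕ} (G : SimpleGraph (Fin n)) : SimpleGraph (Fin (n + 2)) :=
  SimpleGraph.fromRel fun x y =>
    x = 0 ∨ x = Fin.last (n + 1) ∨ ∃ i j : Fin n, G.Adj i j ∧ x = innerVertex i ∧ y = innerVertex j

theorem zero_lt_innerVertex {n : ℕ} (i : Fin n) : (0 : Fin (n + 2)) < innerVertex i :=
  Fin.succ_pos _

theorem innerVertex_lt_last {n : ℕ} (i : Fin n) : innerVertex i < Fin.last (n + 1) := by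
  simp [innerVertex, Fin.lt_def]

theorem hatGraph_adj_zero {n : ℕ} (G : SimpleGraph (Fin n)) (i : Fin n) :
    (hatGraph G).Adj 0 (innerVertex i) :=
  ⟨(zero_lt_innerVertex i).ne, Or.inl (Or.inl rfl)⟩

theorem hatGraph_adj_last {n : ℕ} (G : SimpleGraph (Fin n)) (i : Fin n) :
    (hatGraph G).Adj (Fin.last (n + 1)) (innerVertex i) :=
  ⟨(innerVertex_lt_last i).ne', Or.inl (Or.inr (Or.inl rfl))⟩

open scoped Classical in
/-- `ℓ_G({v, w})` for `v < w`: the greatest vertex `i < v` that is adjacent to `w` in `Ĝ`. -/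
noncomputable def leftVertex {n : ℕ} (G : SimpleGraph (Fin n)) (v w : Fin n) : Fin (n + 2) :=
  (Finset.univ.filter fun i => i < innerVertex v ∧ (hatGraph G).Adj i (innerVertex w)).max'
    ⟨0, by simp [zero_lt_innerVertex, hatGraph_adj_zero]⟩

open scoped Classical in
/-- `r_G({v, w})` for `v < w`: the least vertex `i > w` that is adjacent to `v` in `Ĝ`. -/
noncomputable def rightVertex {n : ℕ} (G : SimpleGraph (Fin n)) (v w : Fin n) : Fin (n + 2) :=
  (Finset.univ.filter fun i => innerVertex w < i ∧ (hatGraph G).Adj i (innerVertex v)).min'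
    ⟨Fin.last (n + 1), by simp [innerVertex_lt_last, hatGraph_adj_last]⟩

/-- The tetrahedron `ξ_G({v, w}) = {ℓ_G({v, w}), v, w, r_G({v, w})}` for `v < w`. -/
noncomputable def xiSimplex {n : ℕ} (G : SimpleGraph (Fin n)) (v w : Fin n) :
    Finset (Fin (n + 2)) :=
  {leftVertex G v w, innerVertex v, innerVertex w, rightVertex G v w}

/-- The collection `Ξ(G)` of the tetrahedra `ξ_G(e)` over all edges `e` of `G`. -/
def XiMap {n : ℕ} (G : SimpleGraph (Fin n)) : Set (Finset (Fin (n + 2))) :=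
  {S | ∃ v w : Fin n, v < w ∧ G.Adj v w ∧ S = xiSimplex G v w}

/-! Geometry is turned into sign patterns. A point of a hull is the moment vector of a weight on the
labels, and two weights with the same moments differ by a signed weight orthogonal to all cubic
polynomials. Such a relation, if nonzero, has five labels of alternating sign
(`exists_alternation`). So hulls of vertex sets can meet outside their common face only if a
triangle of one set interlaces a segment of the other (`Crosses`), and in a triangulation this never
happens.

From triangulations to graphs: the persistence axioms come from looking at the midpoint of a
segment, or just beside it, and testing the tetrahedron found there against quadratic polynomials. A
tetrahedron l < v < w < r of T must be the one assigned to vw, since a better l or r would give a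
crossing edge (`isXi_of_mem`). Conversely, every inner edge vw is the middle edge of some
tetrahedron of T (`exists_middle_edge`). Together these give Ξ(Γ(T)) = T.

From graphs to triangulations: the cone graph is again persistent, all six pairs in a tetrahedron of
Ξ(G) are edges of it, and no edge crosses a triangle of such a tetrahedron (`not_adj_of_crossed`).
Hence the tetrahedra meet properly. For covering, consider the uncrossed triangles lying vertically
below a generic point X. Each is a lower facet of a tetrahedron of Ξ(G), unless it is an upper facet
of the polytope (`exists_isXi_above`). Either X is in that tetrahedron or X lies above one of its
upper facets, at smaller height. A triangle at minimal height therefore yields a tetrahedron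
containing X, and other points follow by closedness. -/

open Filter Topology

variable {n : ℕ}

/-! ### Moment vectors as means of polynomials -/

/-- The mean of `(s - a) * (s - b)` for a distribution whose first moments are the coordinates
of `X`. -/
def quadForm (X : Fin 3 → ℝ) (a b : ℝ) : ℝ := X 1 - (a + b) * X 0 + a * b

/-- The mean of `(s - a) * (s - b) * (s - c)` for a distribution whose first moments are the
coordinates of `X`. -/
def cubicForm (X : Fin 3 → ℝ) (a b c : ℝ) : ℝ :=
  X 2 - (a + b + c) * X 1 + (a * b + b * c + a * c) * X 0 - a * b * c

/-- `lam` is a probability distribution on the labels in `S` with moment vector `X`. -/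
structure IsMomentWeight {m : ℕ} (t : Fin m → ℝ) (S : Set (Fin m)) (X : Fin 3 → ℝ)
    (lam : Fin m → ℝ) : Prop where
  nonneg : ∀ i, 0 ≤ lam i
  support : ∀ i, i ∉ S → lam i = 0
  sum_one : ∑ i, lam i = 1
  moment : ∀ k : Fin 3, ∑ i, lam i * t i ^ ((k : ℕ) + 1) = X k

/-- Passing to weights makes a sign of a polynomial on the labels of `S` into a sign of the
corresponding form at `X`. -/
theorem mem_momentHull_iff {m : ℕ} {t : Fin m → ℝ} {S : Set (Fin m)} {X : Fin 3 → ℝ} :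
    X ∈ momentHull t S ↔ ∃ lam, IsMomentWeight t S X lam := by
  constructor
  · intro hX
    have hsub : momentHull t S ⊆ {Y | ∃ lam, IsMomentWeight t S Y lam} := by
      refine convexHull_min ?_ ?_
      · rintro _ ⟨i, hi, rfl⟩
        refine ⟨Pi.single i 1, ?_, ?_, ?_, ?_⟩
        · intro j
          by_cases h : j = i
          · subst h; simp
          · simp [h]
        · intro j hj
          have : j ≠ i := fun h => hj (h ▸ hi)
          simp [this]
        · simp
        · intro k
          simp [Pi.single_apply, momentCurve]
      · rintro Y ⟨lam, hl⟩ Z ⟨mu, hm⟩ a b ha hb hab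
        refine ⟨fun i => a * lam i + b * mu i, ?_, ?_, ?_, ?_⟩
        · intro i
          have := hl.nonneg i
          have := hm.nonneg i
          positivity
        · intro i hi
          simp [hl.support i hi, hm.support i hi]
        · rw [Finset.sum_add_distrib, ← Finset.mul_sum, ← Finset.mul_sum, hl.sum_one, hm.sum_one]
          linarith
        · intro k
          simp only [add_mul, mul_assoc, Finset.sum_add_distrib, ← Finset.mul_sum, hl.moment k,
            hm.moment k]
          simp
    exact hsub hX
  · rintro ⟨lam, hl⟩
    classical
    have hX : X = ∑ i ∈ Finset.univ.filter (· ∈ S), lam i • momentCurve 3 (t i) := by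
      funext k
      rw [← hl.moment k, Finset.sum_apply, Finset.sum_filter]
      refine Finset.sum_congr rfl fun i _ => ?_
      by_cases hi : i ∈ S
      · simp [hi, momentCurve]
      · simp [hi, hl.support i hi]
    rw [hX]
    refine (convex_convexHull ℝ _).sum_mem (fun i _ => hl.nonneg i) ?_ ?_
    · rw [Finset.sum_filter, ← hl.sum_one]
      refine Finset.sum_congr rfl fun i _ => ?_
      by_cases hi : i ∈ S
      · simp [hi]
      · simp [hi, hl.support i hi]
    · intro i hi
      exact subset_convexHull ℝ _ ⟨i, by simpa using hi, rfl⟩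

theorem isClosed_momentHull {m : ℕ} (t : Fin m → ℝ) (S : Set (Fin m)) :
    IsClosed (momentHull t S) :=
  ((Set.toFinite _).isCompact_convexHull (𝕜 := ℝ)).isClosed

theorem momentHull_mono {m : ℕ} (t : Fin m → ℝ) {S S' : Set (Fin m)} (h : S ⊆ S') :
    momentHull t S ⊆ momentHull t S' :=
  convexHull_mono (Set.image_mono h)

namespace IsMomentWeight

variable {m : ℕ} {t : Fin m → ℝ} {S : Set (Fin m)} {X : Fin 3 → ℝ} {lam : Fin m → ℝ}

theorem sum_quad (h : IsMomentWeight t S X lam) (a b : ℝ) :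
    ∑ i, lam i * ((t i - a) * (t i - b)) = quadForm X a b := by
  have h0 := h.moment 0
  have h1 := h.moment 1
  have e : ∀ i, lam i * ((t i - a) * (t i - b)) =
      lam i * t i ^ (1 + 1) - (a + b) * (lam i * t i ^ (0 + 1)) + a * b * lam i := fun i => by ring
  simp only [e, Finset.sum_add_distrib, Finset.sum_sub_distrib, ← Finset.mul_sum]
  simp only [Fin.val_zero, Fin.val_one] at h0 h1
  rw [h0, h1, h.sum_one, quadForm]
  ring

theorem sum_cubic (h : IsMomentWeight t S X lam) (a b c : ℝ) :
    ∑ i, lam i * ((t i - a) * (t i - b) * (t i - c)) = cubicForm X a b c := by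
  have h0 := h.moment 0
  have h1 := h.moment 1
  have h2 := h.moment 2
  have e : ∀ i, lam i * ((t i - a) * (t i - b) * (t i - c)) =
      lam i * t i ^ (2 + 1) - (a + b + c) * (lam i * t i ^ (1 + 1)) +
        (a * b + b * c + a * c) * (lam i * t i ^ (0 + 1)) - a * b * c * lam i := fun i => by ring
  simp only [e, Finset.sum_add_distrib, Finset.sum_sub_distrib, ← Finset.mul_sum]
  simp only [Fin.val_zero, Fin.val_one, Fin.val_two] at h0 h1 h2
  rw [h0, h1, h2, h.sum_one, cubicForm]
  ring

theorem sum_nonneg (h : IsMomentWeight t S X lam) {f : Fin m → ℝ} (hf : ∀ i ∈ S, 0 ≤ f i) :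
    0 ≤ ∑ i, lam i * f i := by
  refine Finset.sum_nonneg fun i _ => ?_
  by_cases hi : i ∈ S
  · exact mul_nonneg (h.nonneg i) (hf i hi)
  · simp [h.support i hi]

theorem quadForm_nonneg (h : IsMomentWeight t S X lam) {a b : ℝ}
    (hf : ∀ i ∈ S, 0 ≤ (t i - a) * (t i - b)) : 0 ≤ quadForm X a b := by
  rw [← h.sum_quad]
  exact h.sum_nonneg hf

theorem quadForm_nonpos (h : IsMomentWeight t S X lam) {a b : ℝ}
    (hf : ∀ i ∈ S, (t i - a) * (t i - b) ≤ 0) : quadForm X a b ≤ 0 := by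
  rw [← h.sum_quad]
  have := h.sum_nonneg (f := fun i => -((t i - a) * (t i - b)))
    (fun i hi => neg_nonneg.2 (hf i hi))
  simpa using this

theorem cubicForm_nonneg (h : IsMomentWeight t S X lam) {a b c : ℝ}
    (hf : ∀ i ∈ S, 0 ≤ (t i - a) * (t i - b) * (t i - c)) : 0 ≤ cubicForm X a b c := by
  rw [← h.sum_cubic]
  exact h.sum_nonneg hf

theorem cubicForm_nonpos (h : IsMomentWeight t S X lam) {a b c : ℝ}
    (hf : ∀ i ∈ S, (t i - a) * (t i - b) * (t i - c) ≤ 0) : cubicForm X a b c ≤ 0 := by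
  rw [← h.sum_cubic]
  have := h.sum_nonneg (f := fun i => -((t i - a) * (t i - b) * (t i - c)))
    (fun i hi => neg_nonneg.2 (hf i hi))
  simpa using this

end IsMomentWeight

/-! ### Sign changes of relations on the moment curve -/

theorem exists_least_of_exists {m : ℕ} {P : Fin m → Prop} (h : ∃ i, P i) :
    ∃ i, P i ∧ ∀ j, j < i → ¬ P j := by
  obtain ⟨i, hi, hmin⟩ := (wellFounded_lt (α := Fin m)).has_min {i | P i} h
  exact ⟨i, hi, fun j hj hP => hmin j hP hj⟩

theorem exists_greatest_of_exists {m : ℕ} {P : Fin m → Prop} (h : ∃ i, P i) :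
    ∃ i, P i ∧ ∀ j, i < j → ¬ P j := by
  obtain ⟨i, hi, hmin⟩ := (wellFounded_gt (α := Fin m)).has_min {i | P i} h
  exact ⟨i, hi, fun j hj hP => hmin j hP hj⟩

/-- A signed weight is orthogonal to all polynomials of degree at most three. -/
structure IsMomentRelation {m : ℕ} (t : Fin m → ℝ) (nu : Fin m → ℝ) : Prop where
  sum_zero : ∑ i, nu i = 0
  moment : ∀ k : Fin 3, ∑ i, nu i * t i ^ ((k : ℕ) + 1) = 0

namespace IsMomentRelation

variable {m : ℕ} {t : Fin m → ℝ} {nu : Fin m → ℝ}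

theorem neg (h : IsMomentRelation t nu) : IsMomentRelation t (fun i => -nu i) :=
  ⟨by simp [h.sum_zero], fun k => by simp [h.moment k]⟩

theorem sum_cubic (h : IsMomentRelation t nu) (c₀ c₁ c₂ c₃ : ℝ) :
    ∑ i, nu i * (c₀ + c₁ * t i + c₂ * t i ^ 2 + c₃ * t i ^ 3) = 0 := by
  have h0 := h.moment 0
  have h1 := h.moment 1
  have h2 := h.moment 2
  have e : ∀ i, nu i * (c₀ + c₁ * t i + c₂ * t i ^ 2 + c₃ * t i ^ 3) =
      c₀ * nu i + c₁ * (nu i * t i ^ (0 + 1)) + c₂ * (nu i * t i ^ (1 + 1)) +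
        c₃ * (nu i * t i ^ (2 + 1)) := fun i => by ring
  simp only [e, Finset.sum_add_distrib, ← Finset.mul_sum]
  simp only [Fin.val_zero, Fin.val_one, Fin.val_two] at h0 h1 h2
  rw [h0, h1, h2, h.sum_zero]
  ring

theorem false_of_nonneg (h : IsMomentRelation t nu) (c₀ c₁ c₂ c₃ : ℝ) {f : ℝ → ℝ}
    (hf : ∀ s, f s = c₀ + c₁ * s + c₂ * s ^ 2 + c₃ * s ^ 3)
    (hnn : ∀ i, 0 ≤ nu i * f (t i)) {i : Fin m} (hi : 0 < nu i * f (t i)) : False := by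
  have h0 : ∑ i, nu i * f (t i) = 0 := by
    simp only [hf]
    exact h.sum_cubic c₀ c₁ c₂ c₃
  have := Finset.sum_pos' (s := Finset.univ) (fun i _ => hnn i) ⟨i, Finset.mem_univ i, hi⟩
  linarith

/-- With fewer than four sign changes, a polynomial of degree at most three with its roots at the
first labels of the later sign blocks has the sign of `nu` everywhere and is positive at `a`; its
pairing with `nu` could not vanish. The blocks are split off one at a time. -/
theorem exists_alternation_of_pos (h : IsMomentRelation t nu) (ht : StrictMono t) {a : Fin m}
    (ha : 0 < nu a) (hlt : ∀ j, j < a → nu j = 0) :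
    ∃ b c d e, a < b ∧ b < c ∧ c < d ∧ d < e ∧ nu b < 0 ∧ 0 < nu c ∧ nu d < 0 ∧ 0 < nu e := by
  have hb : ∃ b, a < b ∧ nu b < 0 := by
    by_contra! hcon
    have hnn : ∀ j, 0 ≤ nu j := by
      intro j
      rcases lt_trichotomy j a with hj | hj | hj
      · exact (hlt j hj).ge
      · exact hj ▸ ha.le
      · exact hcon j hj
    exact h.false_of_nonneg 1 0 0 0 (f := fun _ => 1) (fun s => by ring)
      (fun j => by simpa using hnn j) (i := a) (by simpa using ha)
  obtain ⟨b, ⟨hab, hb⟩, hbmin⟩ := exists_least_of_exists hb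
  have s1 : ∀ j, j < b → 0 ≤ nu j := by
    intro j hj
    rcases lt_trichotomy j a with h1 | h1 | h1
    · exact (hlt j h1).ge
    · exact h1 ▸ ha.le
    · by_contra! hcon
      exact hbmin j hj ⟨h1, hcon⟩
  have hc : ∃ c, b < c ∧ 0 < nu c := by
    by_contra! hcon
    refine h.false_of_nonneg (t b) (-1) 0 0 (f := fun s => t b - s) (fun s => by ring)
      (fun j => ?_) (i := a) (mul_pos ha (sub_pos.2 (ht hab)))
    rcases lt_or_ge j b with h1 | h1
    · exact mul_nonneg (s1 j h1) (sub_nonneg.2 (ht.monotone h1.le))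
    · have hj : nu j ≤ 0 := by
        rcases h1.eq_or_lt with h2 | h2
        · exact h2 ▸ hb.le
        · exact hcon j h2
      exact mul_nonneg_of_nonpos_of_nonpos hj (sub_nonpos.2 (ht.monotone h1))
  obtain ⟨c, ⟨hbc, hc⟩, hcmin⟩ := exists_least_of_exists hc
  have s2 : ∀ j, b ≤ j → j < c → nu j ≤ 0 := by
    intro j hj hjc
    rcases hj.eq_or_lt with h1 | h1
    · exact h1 ▸ hb.le
    · by_contra! hcon
      exact hcmin j hjc ⟨h1, hcon⟩
  have hd : ∃ d, c < d ∧ nu d < 0 := by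
    by_contra! hcon
    refine h.false_of_nonneg (t b * t c) (-(t b + t c)) 1 0 (f := fun s => (t b - s) * (t c - s))
      (fun s => by ring) (fun j => ?_) (i := a)
      (mul_pos ha (mul_pos (sub_pos.2 (ht hab)) (sub_pos.2 (ht (hab.trans hbc)))))
    rcases lt_or_ge j b with h1 | h1
    · exact mul_nonneg (s1 j h1) (mul_nonneg (sub_nonneg.2 (ht.monotone h1.le))
        (sub_nonneg.2 (ht.monotone (h1.trans hbc).le)))
    · rcases lt_or_ge j c with h2 | h2
      · exact mul_nonneg_of_nonpos_of_nonpos (s2 j h1 h2)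
          (mul_nonpos_of_nonpos_of_nonneg (sub_nonpos.2 (ht.monotone h1))
            (sub_nonneg.2 (ht.monotone h2.le)))
      · have hj : 0 ≤ nu j := by
          rcases h2.eq_or_lt with h3 | h3
          · exact h3 ▸ hc.le
          · exact hcon j h3
        exact mul_nonneg hj (mul_nonneg_of_nonpos_of_nonpos (sub_nonpos.2 (ht.monotone h1))
            (sub_nonpos.2 (ht.monotone h2)))
  obtain ⟨d, ⟨hcd, hd⟩, hdmin⟩ := exists_least_of_exists hd
  have s3 : ∀ j, c ≤ j → j < d → 0 ≤ nu j := by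
    intro j hj hjc
    rcases hj.eq_or_lt with h1 | h1
    · exact h1 ▸ hc.le
    · by_contra! hcon
      exact hdmin j hjc ⟨h1, hcon⟩
  have he : ∃ e, d < e ∧ 0 < nu e := by
    by_contra! hcon
    refine h.false_of_nonneg (t b * t c * t d) (-(t b * t c + t c * t d + t b * t d))
      (t b + t c + t d) (-1) (f := fun s => (t b - s) * (t c - s) * (t d - s))
      (fun s => by ring) (fun j => ?_) (i := a)
      (mul_pos ha (mul_pos (mul_pos (sub_pos.2 (ht hab)) (sub_pos.2 (ht (hab.trans hbc))))
        (sub_pos.2 (ht (hab.trans (hbc.trans hcd))))))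
    rcases lt_or_ge j b with h1 | h1
    · exact mul_nonneg (s1 j h1) (mul_nonneg (mul_nonneg (sub_nonneg.2 (ht.monotone h1.le))
        (sub_nonneg.2 (ht.monotone (h1.trans hbc).le)))
        (sub_nonneg.2 (ht.monotone (h1.trans (hbc.trans hcd)).le)))
    · rcases lt_or_ge j c with h2 | h2
      · exact mul_nonneg_of_nonpos_of_nonpos (s2 j h1 h2)
          (mul_nonpos_of_nonpos_of_nonneg (mul_nonpos_of_nonpos_of_nonneg
            (sub_nonpos.2 (ht.monotone h1)) (sub_nonneg.2 (ht.monotone h2.le)))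
            (sub_nonneg.2 (ht.monotone (h2.trans hcd).le)))
      · rcases lt_or_ge j d with h3 | h3
        · exact mul_nonneg (s3 j h2 h3) (mul_nonneg (mul_nonneg_of_nonpos_of_nonpos
            (sub_nonpos.2 (ht.monotone h1)) (sub_nonpos.2 (ht.monotone h2)))
            (sub_nonneg.2 (ht.monotone h3.le)))
        · have hj : nu j ≤ 0 := by
            rcases h3.eq_or_lt with h4 | h4
            · exact h4 ▸ hd.le
            · exact hcon j h4
          exact mul_nonneg_of_nonpos_of_nonpos hj (mul_nonpos_of_nonneg_of_nonpos
            (mul_nonneg_of_nonpos_of_nonpos (sub_nonpos.2 (ht.monotone h1))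
              (sub_nonpos.2 (ht.monotone h2))) (sub_nonpos.2 (ht.monotone h3)))
  obtain ⟨e, hde, he⟩ := he
  exact ⟨b, c, d, e, hab, hbc, hcd, hde, hb, hc, hd, he⟩

/-- A nonzero relation between points of the moment curve in dimension three has at least four
sign changes. -/
theorem exists_alternation (h : IsMomentRelation t nu) (ht : StrictMono t) (hnu : nu ≠ 0) :
    ∃ a b c d e, a < b ∧ b < c ∧ c < d ∧ d < e ∧
      ((0 < nu a ∧ nu b < 0 ∧ 0 < nu c ∧ nu d < 0 ∧ 0 < nu e) ∨
        (nu a < 0 ∧ 0 < nu b ∧ nu c < 0 ∧ 0 < nu d ∧ nu e < 0)) := by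
  obtain ⟨a, ha, hmin⟩ := exists_least_of_exists (Function.ne_iff.1 hnu)
  have hz : ∀ j, j < a → nu j = 0 := fun j hj => not_not.1 (hmin j hj)
  rcases lt_or_gt_of_ne ha with h1 | h1
  · obtain ⟨b, c, d, e, hab, hbc, hcd, hde, hb, hc, hd, he⟩ :=
      h.neg.exists_alternation_of_pos ht (a := a) (by simpa using h1)
        (fun j hj => by simp [hz j hj])
    exact ⟨a, b, c, d, e, hab, hbc, hcd, hde, Or.inr ⟨h1, by simpa using hb, by simpa using hc,
      by simpa using hd, by simpa using he⟩⟩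
  · obtain ⟨b, c, d, e, hab, hbc, hcd, hde, hb, hc, hd, he⟩ :=
      h.exists_alternation_of_pos ht h1 hz
    exact ⟨a, b, c, d, e, hab, hbc, hcd, hde, Or.inl ⟨h1, hb, hc, hd, he⟩⟩

end IsMomentRelation

theorem five_le_card {m : ℕ} {S : Finset (Fin m)} {a b c d e : Fin m} (hab : a < b) (hbc : b < c)
    (hcd : c < d) (hde : d < e) (ha : a ∈ S) (hb : b ∈ S) (hc : c ∈ S) (hd : d ∈ S)
    (he : e ∈ S) : 5 ≤ S.card := by
  have hsub : ({a, b, c, d, e} : Finset (Fin m)) ⊆ S := by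
    intro i hi
    simp only [Finset.mem_insert, Finset.mem_singleton] at hi
    rcases hi with rfl | rfl | rfl | rfl | rfl <;> assumption
  refine le_trans (le_of_eq ?_) (Finset.card_le_card hsub)
  rw [Finset.card_insert_of_notMem, Finset.card_insert_of_notMem, Finset.card_insert_of_notMem,
    Finset.card_insert_of_notMem, Finset.card_singleton] <;>
  simp only [Finset.mem_insert, Finset.mem_singleton, not_or] <;> omega

/-! ### Uniqueness of weights, intersections and interlacing -/

theorem IsMomentWeight.sub {m : ℕ} {t : Fin m → ℝ} {S S' : Set (Fin m)} {X : Fin 3 → ℝ}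
    {lam mu : Fin m → ℝ} (h : IsMomentWeight t S X lam) (h' : IsMomentWeight t S' X mu) :
    IsMomentRelation t (fun i => lam i - mu i) :=
  ⟨by simp [h.sum_one, h'.sum_one], fun k => by
    simp [sub_mul, Finset.sum_sub_distrib, h.moment k, h'.moment k]⟩

/-- Weights on at most four points are determined by their moments. -/
theorem IsMomentWeight.eq_of_card_le {m : ℕ} {t : Fin m → ℝ} (ht : StrictMono t)
    {S : Finset (Fin m)} (hS : S.card ≤ 4) {X : Fin 3 → ℝ} {lam mu : Fin m → ℝ}
    (h : IsMomentWeight t S X lam) (h' : IsMomentWeight t S X mu) : lam = mu := by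
  by_contra hne
  have hnu : (fun i => lam i - mu i) ≠ 0 := fun h0 =>
    hne (funext fun i => sub_eq_zero.1 (congrFun h0 i))
  obtain ⟨a, b, c, d, e, hab, hbc, hcd, hde, hs⟩ := (h.sub h').exists_alternation ht hnu
  have hmem : ∀ i, lam i - mu i ≠ 0 → i ∈ S := by
    intro i hi
    by_contra hiS
    exact hi (by rw [h.support i (by simpa using hiS), h'.support i (by simpa using hiS), sub_zero])
  have h5 : 5 ≤ S.card := by
    rcases hs with ⟨ha, hb, hc, hd, he⟩ | ⟨ha, hb, hc, hd, he⟩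
    · exact five_le_card hab hbc hcd hde (hmem a ha.ne') (hmem b hb.ne) (hmem c hc.ne')
        (hmem d hd.ne) (hmem e he.ne')
    · exact five_le_card hab hbc hcd hde (hmem a ha.ne) (hmem b hb.ne') (hmem c hc.ne)
        (hmem d hd.ne') (hmem e he.ne)
  omega

theorem IsMomentWeight.mono {m : ℕ} {t : Fin m → ℝ} {S S' : Set (Fin m)} {X : Fin 3 → ℝ}
    {lam : Fin m → ℝ} (h : IsMomentWeight t S X lam) (hS : S ⊆ S') : IsMomentWeight t S' X lam :=
  ⟨h.nonneg, fun i hi => h.support i fun h1 => hi (hS h1), h.sum_one, h.moment⟩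

/-- Two vertex sets are crossed if a triangle of one is pierced by a segment of the other. -/
def Crosses {m : ℕ} (S S' : Finset (Fin m)) : Prop :=
  ∃ a b c d e, a < b ∧ b < c ∧ c < d ∧ d < e ∧ a ∈ S ∧ c ∈ S ∧ e ∈ S ∧ b ∈ S' ∧ d ∈ S'

/-- The difference of two weights of a common point is positive only on `S` and negative only on
`S'`, so an alternation of it is a crossing. Without crossings the weights agree and live on the
common labels. -/
theorem momentHull_inter_of_not_crosses {m : ℕ} {t : Fin m → ℝ} (ht : StrictMono t)
    {S S' : Finset (Fin m)} (h : ¬ Crosses S S') (h' : ¬ Crosses S' S) :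
    momentHull t (S : Set (Fin m)) ∩ momentHull t (S' : Set (Fin m)) =
      momentHull t ((S : Set (Fin m)) ∩ (S' : Set (Fin m))) := by
  refine Set.Subset.antisymm ?_ (Set.subset_inter (momentHull_mono t Set.inter_subset_left)
    (momentHull_mono t Set.inter_subset_right))
  rintro X ⟨hX, hX'⟩
  obtain ⟨lam, hl⟩ := mem_momentHull_iff.1 hX
  obtain ⟨mu, hm⟩ := mem_momentHull_iff.1 hX'
  have hpos : ∀ i, 0 < lam i - mu i → i ∈ S := by
    intro i hi
    by_contra hiS
    have := hl.support i (by simpa using hiS)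
    have := hm.nonneg i
    linarith
  have hneg : ∀ i, lam i - mu i < 0 → i ∈ S' := by
    intro i hi
    by_contra hiS
    have := hm.support i (by simpa using hiS)
    have := hl.nonneg i
    linarith
  have heq : lam = mu := by
    by_contra hne
    have hnu : (fun i => lam i - mu i) ≠ 0 := fun h0 =>
      hne (funext fun i => sub_eq_zero.1 (congrFun h0 i))
    obtain ⟨a, b, c, d, e, hab, hbc, hcd, hde, hs⟩ := (hl.sub hm).exists_alternation ht hnu
    rcases hs with ⟨ha, hb, hc, hd, he⟩ | ⟨ha, hb, hc, hd, he⟩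
    · exact h ⟨a, b, c, d, e, hab, hbc, hcd, hde, hpos _ ha, hpos _ hc, hpos _ he, hneg _ hb,
        hneg _ hd⟩
    · exact h' ⟨a, b, c, d, e, hab, hbc, hcd, hde, hneg _ ha, hneg _ hc, hneg _ he, hpos _ hb,
        hpos _ hd⟩
  subst heq
  refine mem_momentHull_iff.2 ⟨lam, hl.nonneg, fun i hi => ?_, hl.sum_one, hl.moment⟩
  by_cases h1 : i ∈ (S : Set (Fin m))
  · exact hm.support i fun h2 => hi ⟨h1, h2⟩
  · exact hl.support i h1

/-- A point is in the tetrahedron on `a < b < c < d` if it is above the two lower and below the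
two upper facets. -/
theorem mem_momentHull_of_cubicForm {m : ℕ} {t : Fin m → ℝ} (ht : StrictMono t)
    {a b c d : Fin m} (hab : a < b) (hbc : b < c) (hcd : c < d) {X : Fin 3 → ℝ}
    (h1 : 0 ≤ cubicForm X (t a) (t b) (t c)) (h2 : 0 ≤ cubicForm X (t a) (t c) (t d))
    (h3 : cubicForm X (t a) (t b) (t d) ≤ 0) (h4 : cubicForm X (t b) (t c) (t d) ≤ 0) :
    X ∈ momentHull t (({a, b, c, d} : Finset (Fin m)) : Set (Fin m)) := by
  have pab : 0 < t b - t a := sub_pos.2 (ht hab)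
  have pbc : 0 < t c - t b := sub_pos.2 (ht hbc)
  have pcd : 0 < t d - t c := sub_pos.2 (ht hcd)
  have pac : 0 < t c - t a := by linarith
  have pbd : 0 < t d - t b := by linarith
  have pad : 0 < t d - t a := by linarith
  -- The barycentric coordinates are the means of the Lagrange basis polynomials; the minus signs
  -- arise from writing the denominators with positive differences.
  have hw : X = (-cubicForm X (t b) (t c) (t d) / ((t b - t a) * (t c - t a) * (t d - t a))) •
        momentCurve 3 (t a) +
      (cubicForm X (t a) (t c) (t d) / ((t b - t a) * (t c - t b) * (t d - t b))) •
        momentCurve 3 (t b) +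
      (-cubicForm X (t a) (t b) (t d) / ((t c - t a) * (t c - t b) * (t d - t c))) •
        momentCurve 3 (t c) +
      (cubicForm X (t a) (t b) (t c) / ((t d - t a) * (t d - t b) * (t d - t c))) •
        momentCurve 3 (t d) := by
    funext k
    fin_cases k <;> simp [momentCurve, cubicForm] <;> field_simp <;> ring
  have hs : (-cubicForm X (t b) (t c) (t d) / ((t b - t a) * (t c - t a) * (t d - t a))) +
      (cubicForm X (t a) (t c) (t d) / ((t b - t a) * (t c - t b) * (t d - t b))) +
      (-cubicForm X (t a) (t b) (t d) / ((t c - t a) * (t c - t b) * (t d - t c))) +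
      (cubicForm X (t a) (t b) (t c) / ((t d - t a) * (t d - t b) * (t d - t c))) = 1 := by
    simp only [cubicForm]
    field_simp
    ring
  have w1 : 0 ≤ -cubicForm X (t b) (t c) (t d) / ((t b - t a) * (t c - t a) * (t d - t a)) :=
    div_nonneg (by linarith) (by positivity)
  have w2 : 0 ≤ cubicForm X (t a) (t c) (t d) / ((t b - t a) * (t c - t b) * (t d - t b)) :=
    div_nonneg (by linarith) (by positivity)
  have w3 : 0 ≤ -cubicForm X (t a) (t b) (t d) / ((t c - t a) * (t c - t b) * (t d - t c)) :=
    div_nonneg (by linarith) (by positivity)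
  have w4 : 0 ≤ cubicForm X (t a) (t b) (t c) / ((t d - t a) * (t d - t b) * (t d - t c)) :=
    div_nonneg (by linarith) (by positivity)
  have hmem : ∀ i ∈ ({a, b, c, d} : Finset (Fin m)), momentCurve 3 (t i) ∈
      momentHull t (({a, b, c, d} : Finset (Fin m)) : Set (Fin m)) := fun i hi =>
    subset_convexHull ℝ _ ⟨i, by simpa using hi, rfl⟩
  have key := (convex_convexHull ℝ ((fun i => momentCurve 3 (t i)) ''
      (({a, b, c, d} : Finset (Fin m)) : Set (Fin m)))).sum_mem (t := Finset.univ)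
    (w := ![-cubicForm X (t b) (t c) (t d) / ((t b - t a) * (t c - t a) * (t d - t a)),
      cubicForm X (t a) (t c) (t d) / ((t b - t a) * (t c - t b) * (t d - t b)),
      -cubicForm X (t a) (t b) (t d) / ((t c - t a) * (t c - t b) * (t d - t c)),
      cubicForm X (t a) (t b) (t c) / ((t d - t a) * (t d - t b) * (t d - t c))])
    (z := ![momentCurve 3 (t a), momentCurve 3 (t b), momentCurve 3 (t c), momentCurve 3 (t d)])
    (by
      intro i _
      fin_cases i
      · exact w1
      · exact w2
      · exact w3
      · exact w4)
    (by
      rw [Fin.sum_univ_four]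
      exact hs)
    (by
      intro i _
      fin_cases i
      · exact hmem a (by simp)
      · exact hmem b (by simp)
      · exact hmem c (by simp)
      · exact hmem d (by simp))
  rw [Fin.sum_univ_four] at key
  rw [hw]
  exact key

/-- Five points of the moment curve in dimension three satisfy an alternating relation. -/
theorem exists_alternating_relation {u : Fin 5 → ℝ} (hu : StrictMono u) :
    ∃ g, IsMomentRelation u g ∧ 0 < g 0 ∧ g 1 < 0 ∧ 0 < g 2 ∧ g 3 < 0 ∧ 0 < g 4 := by
  let L : (Fin 5 → ℝ) →ₗ[ℝ] (Fin 4 → ℝ) :=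
    { toFun := fun g k => ∑ i, g i * u i ^ (k : ℕ)
      map_add' := fun g h => by
        funext k
        simp [add_mul, Finset.sum_add_distrib]
      map_smul' := fun c g => by
        funext k
        simp [mul_assoc, Finset.mul_sum] }
  -- Five unknowns and four equations; the alternation below then has to use up all five labels in
  -- order.
  have hker : LinearMap.ker L ≠ ⊥ := LinearMap.ker_ne_bot_of_finrank_lt (by simp)
  obtain ⟨g, hg, hg0⟩ := (Submodule.ne_bot_iff _).1 hker
  have hL : ∀ k : Fin 4, ∑ i, g i * u i ^ (k : ℕ) = 0 := fun k =>
    congrFun (LinearMap.mem_ker.1 hg) k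
  have hrel : IsMomentRelation u g :=
    ⟨by simpa using hL 0, fun k => by simpa using hL k.succ⟩
  obtain ⟨a, b, c, d, e, hab, hbc, hcd, hde, hs⟩ := hrel.exists_alternation hu hg0
  obtain rfl : a = 0 := by omega
  obtain rfl : b = 1 := by omega
  obtain rfl : c = 2 := by omega
  obtain rfl : d = 3 := by omega
  obtain rfl : e = 4 := by omega
  rcases hs with hs | hs
  · exact ⟨g, hrel, hs⟩
  · exact ⟨_, hrel.neg, by simpa using hs⟩

/-- The triangle on `a < c < e` is pierced by the segment on `b < d` if these are interlaced. -/
theorem exists_weights_of_interlaced {m : ℕ} {t : Fin m → ℝ} (ht : StrictMono t)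
    {a b c d e : Fin m} (hab : a < b) (hbc : b < c) (hcd : c < d) (hde : d < e) :
    ∃ X lam mu, IsMomentWeight t {a, c, e} X lam ∧ IsMomentWeight t {b, d} X mu ∧
      0 < lam a ∧ 0 < lam c ∧ 0 < lam e := by
  have hu : StrictMono (t ∘ ![a, b, c, d, e]) := by
    refine ht.comp (Fin.strictMono_iff_lt_succ.2 fun i => ?_)
    fin_cases i
    · exact hab
    · exact hbc
    · exact hcd
    · exact hde
  obtain ⟨g, hg, h0, h1, h2, h3, h4⟩ := exists_alternating_relation hu
  have e0 := hg.sum_zero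
  simp only [Fin.sum_univ_five] at e0
  -- The positive and the negative part of the relation have this same total mass; dividing by it
  -- gives two weights with equal moments.
  have hs : 0 < g 0 + g 2 + g 4 := by linarith
  have hsum : ∀ (x y z : ℝ) (f : Fin m → ℝ),
      ∑ i, ((Pi.single a x : Fin m → ℝ) i + (Pi.single c y : Fin m → ℝ) i +
        (Pi.single e z : Fin m → ℝ) i) * f i = x * f a + y * f c + z * f e := by
    intro x y z f
    simp [add_mul, Finset.sum_add_distrib, Pi.single_apply]
  have hsum' : ∀ (x y : ℝ) (f : Fin m → ℝ),
      ∑ i, ((Pi.single b x : Fin m → ℝ) i + (Pi.single d y : Fin m → ℝ) i) * f i =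
        x * f b + y * f d := by
    intro x y f
    simp [add_mul, Finset.sum_add_distrib, Pi.single_apply]
  have hsingle : ∀ (j : Fin m) (x : ℝ), 0 ≤ x → ∀ i, 0 ≤ (Pi.single j x : Fin m → ℝ) i := by
    intro j x hx i
    rw [Pi.single_apply]
    split_ifs
    · exact hx
    · exact le_rfl
  have p0 := div_pos h0 hs
  have p2 := div_pos h2 hs
  have p4 := div_pos h4 hs
  have p1 := div_pos (neg_pos.2 h1) hs
  have p3 := div_pos (neg_pos.2 h3) hs
  refine ⟨fun k => (g 0 / (g 0 + g 2 + g 4)) * t a ^ ((k : ℕ) + 1) +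
      (g 2 / (g 0 + g 2 + g 4)) * t c ^ ((k : ℕ) + 1) +
      (g 4 / (g 0 + g 2 + g 4)) * t e ^ ((k : ℕ) + 1),
    fun i => (Pi.single a (g 0 / (g 0 + g 2 + g 4)) : Fin m → ℝ) i +
      (Pi.single c (g 2 / (g 0 + g 2 + g 4)) : Fin m → ℝ) i +
      (Pi.single e (g 4 / (g 0 + g 2 + g 4)) : Fin m → ℝ) i,
    fun i => (Pi.single b (-g 1 / (g 0 + g 2 + g 4)) : Fin m → ℝ) i +
      (Pi.single d (-g 3 / (g 0 + g 2 + g 4)) : Fin m → ℝ) i,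
    ⟨fun i => ?_, fun i hi => ?_, ?_, fun k => ?_⟩, ⟨fun i => ?_, fun i hi => ?_, ?_, fun k => ?_⟩,
    ?_, ?_, ?_⟩
  · have := hsingle a _ p0.le i
    have := hsingle c _ p2.le i
    have := hsingle e _ p4.le i
    positivity
  · simp only [Set.mem_insert_iff, Set.mem_singleton_iff, not_or] at hi
    simp [hi.1, hi.2.1, hi.2.2]
  · have := hsum (g 0 / (g 0 + g 2 + g 4)) (g 2 / (g 0 + g 2 + g 4)) (g 4 / (g 0 + g 2 + g 4))
      (fun _ => 1)
    simp only [mul_one] at this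
    rw [this]
    field_simp
  · exact hsum _ _ _ _
  · have := hsingle b _ p1.le i
    have := hsingle d _ p3.le i
    positivity
  · simp only [Set.mem_insert_iff, Set.mem_singleton_iff, not_or] at hi
    simp [hi.1, hi.2]
  · have := hsum' (-g 1 / (g 0 + g 2 + g 4)) (-g 3 / (g 0 + g 2 + g 4)) (fun _ => 1)
    simp only [mul_one] at this
    rw [this]
    field_simp
    linarith
  · rw [hsum']
    have := hg.moment k
    simp only [Fin.sum_univ_five, Function.comp] at this
    simp only [Matrix.cons_val] at this
    field_simp
    linarith
  · simp [(hab.trans hbc).ne, (hab.trans (hbc.trans (hcd.trans hde))).ne, h0, hs]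
  · simp [(hab.trans hbc).ne', (hcd.trans hde).ne, h2, hs]
  · simp [(hcd.trans hde).ne', (hab.trans (hbc.trans (hcd.trans hde))).ne', h4, hs]

/-! ### Affinity of the forms, and midpoints of edges -/

theorem quadForm_combo {a b : ℝ} (h : a + b = 1) (X Y : Fin 3 → ℝ) (x y : ℝ) :
    quadForm (a • X + b • Y) x y = a * quadForm X x y + b * quadForm Y x y := by
  obtain rfl : b = 1 - a := by linarith
  simp only [quadForm, Pi.add_apply, Pi.smul_apply, smul_eq_mul]
  ring

theorem cubicForm_combo {a b : ℝ} (h : a + b = 1) (X Y : Fin 3 → ℝ) (x y z : ℝ) :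
    cubicForm (a • X + b • Y) x y z = a * cubicForm X x y z + b * cubicForm Y x y z := by
  obtain rfl : b = 1 - a := by linarith
  simp only [cubicForm, Pi.add_apply, Pi.smul_apply, smul_eq_mul]
  ring

theorem quadForm_momentCurve (s x y : ℝ) :
    quadForm (momentCurve 3 s) x y = (s - x) * (s - y) := by
  simp [quadForm, momentCurve]
  ring

theorem cubicForm_momentCurve (s x y z : ℝ) :
    cubicForm (momentCurve 3 s) x y z = (s - x) * (s - y) * (s - z) := by
  simp [cubicForm, momentCurve]
  ring

theorem momentCurve_mem_momentHull {m : ℕ} (t : Fin m → ℝ) {S : Set (Fin m)} {i : Fin m}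
    (hi : i ∈ S) : momentCurve 3 (t i) ∈ momentHull t S :=
  subset_convexHull ℝ _ ⟨i, hi, rfl⟩

/-- The midpoint of the segment between two points of the moment curve. -/
noncomputable def edgeMidpoint {m : ℕ} (t : Fin m → ℝ) (v w : Fin m) : Fin 3 → ℝ :=
  (1 / 2 : ℝ) • momentCurve 3 (t v) + (1 / 2 : ℝ) • momentCurve 3 (t w)

theorem isMomentWeight_edgeMidpoint {m : ℕ} (t : Fin m → ℝ) {v w : Fin m} :
    IsMomentWeight t {v, w} (edgeMidpoint t v w)
      (fun i => (Pi.single v (1 / 2) : Fin m → ℝ) i + (Pi.single w (1 / 2) : Fin m → ℝ) i) := by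
  have hsum : ∀ (f : Fin m → ℝ),
      ∑ i, ((Pi.single v (1 / 2) : Fin m → ℝ) i + (Pi.single w (1 / 2) : Fin m → ℝ) i) * f i =
        1 / 2 * f v + 1 / 2 * f w := by
    intro f
    simp [add_mul, Finset.sum_add_distrib, Pi.single_apply]
  refine ⟨fun i => ?_, fun i hi => ?_, ?_, fun k => ?_⟩
  · simp only [Pi.single_apply]
    split_ifs <;> norm_num
  · simp only [Set.mem_insert_iff, Set.mem_singleton_iff, not_or] at hi
    simp [hi.1, hi.2]
  · have := hsum (fun _ => 1)
    simp only [mul_one] at this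
    rw [this]
    norm_num
  · rw [hsum]
    simp [edgeMidpoint, momentCurve]

theorem edgeMidpoint_mem {m : ℕ} (t : Fin m → ℝ) (v w : Fin m) :
    edgeMidpoint t v w ∈ cyclicPolytope3 t :=
  momentHull_mono t (Set.subset_univ _) (mem_momentHull_iff.2 ⟨_, isMomentWeight_edgeMidpoint t⟩)

/-- By uniqueness of weights on `S`, any weight of the midpoint on the common labels is the obvious
one, which charges both `v` and `w`. -/
theorem mem_of_edgeMidpoint_mem {m : ℕ} {t : Fin m → ℝ} (ht : StrictMono t) {S : Finset (Fin m)}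
    (hS : S.card ≤ 4) {v w : Fin m} (hv : v ∈ S) (hw : w ∈ S) {S' : Set (Fin m)}
    (h : edgeMidpoint t v w ∈ momentHull t ((S : Set (Fin m)) ∩ S')) : v ∈ S' ∧ w ∈ S' := by
  obtain ⟨lam, hl⟩ := mem_momentHull_iff.1 h
  have hm := (isMomentWeight_edgeMidpoint t (v := v) (w := w)).mono (S' := S) (by
    rintro i (rfl | rfl)
    · exact hv
    · exact hw)
  have heq := (hl.mono Set.inter_subset_left).eq_of_card_le ht hS hm
  have hpos : ∀ i, 0 < lam i → i ∈ S' := by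
    intro i hi
    by_contra hiS
    exact hi.ne' (hl.support i fun h1 => hiS h1.2)
  constructor
  · refine hpos v ?_
    rw [heq]
    simp only [Pi.single_apply]
    split_ifs <;> norm_num at *
  · refine hpos w ?_
    rw [heq]
    simp only [Pi.single_apply]
    split_ifs <;> norm_num at *

/-! ### Edges of a triangulation -/

namespace IsCyclicTriangulation

variable {m : ℕ} {t : Fin m → ℝ} {T : Set (Finset (Fin m))}

theorem exists_mem (hT : IsCyclicTriangulation t T) {X : Fin 3 → ℝ} (hX : X ∈ cyclicPolytope3 t) :
    ∃ S ∈ T, X ∈ momentHull t (S : Set (Fin m)) := by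
  rw [← hT.cover] at hX
  simpa using hX

/-- The piercing point has positive weight at all three triangle vertices. It lies in the hull of
the common labels, so uniqueness of weights on `S` forces these vertices into `S'`, which would then
have five elements. -/
theorem not_crosses (hT : IsCyclicTriangulation t T) (ht : StrictMono t) {S S' : Finset (Fin m)}
    (hS : S ∈ T) (hS' : S' ∈ T) : ¬ Crosses S S' := by
  rintro ⟨a, b, c, d, e, hab, hbc, hcd, hde, ha, hc, he, hb, hd⟩
  obtain ⟨X, lam, mu, hl, hm, hla, hlc, hle⟩ := exists_weights_of_interlaced ht hab hbc hcd hde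
  have hlS : IsMomentWeight t S X lam := hl.mono (by
    rintro i (rfl | rfl | rfl)
    · exact ha
    · exact hc
    · exact he)
  have hmS : IsMomentWeight t S' X mu := hm.mono (by
    rintro i (rfl | rfl)
    · exact hb
    · exact hd)
  have hX : X ∈ momentHull t ((S : Set (Fin m)) ∩ (S' : Set (Fin m))) := by
    rw [← hT.inter S hS S' hS']
    exact ⟨mem_momentHull_iff.2 ⟨lam, hlS⟩, mem_momentHull_iff.2 ⟨mu, hmS⟩⟩
  obtain ⟨rho, hr⟩ := mem_momentHull_iff.1 hX
  have heq := hlS.eq_of_card_le ht (hT.card_eq S hS).le (hr.mono Set.inter_subset_left)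
  have hpos : ∀ i, 0 < lam i → i ∈ S' := by
    intro i hi
    by_contra hiS
    exact hi.ne' (heq ▸ hr.support i fun h1 => hiS h1.2)
  have := five_le_card hab hbc hcd hde (hpos a hla) hb (hpos c hlc) hd (hpos e hle)
  have := hT.card_eq S' hS'
  omega

/-- Every point of the polytope near an edge of a triangulation is in a tetrahedron with
that edge. -/
theorem exists_mem_near_edge (hT : IsCyclicTriangulation t T) (ht : StrictMono t)
    {S : Finset (Fin m)} (hS : S ∈ T) {v w : Fin m} (hv : v ∈ S) (hw : w ∈ S) {Y : Fin 3 → ℝ}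
    (hY : Y ∈ cyclicPolytope3 t) :
    ∃ S' ∈ T, v ∈ S' ∧ w ∈ S' ∧ ∃ ε : ℝ, 0 < ε ∧
      (1 - ε) • edgeMidpoint t v w + ε • Y ∈ momentHull t (S' : Set (Fin m)) := by
  set q : ℝ → Fin 3 → ℝ := fun ε => (1 - ε) • edgeMidpoint t v w + ε • Y with hq
  have hcont : Continuous q := by fun_prop
  have hq0 : Tendsto q (𝓝[>] 0) (𝓝 (edgeMidpoint t v w)) := by
    have := (hcont.tendsto 0).mono_left (nhdsWithin_le_nhds (s := Set.Ioi (0 : ℝ)))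
    simpa [hq] using this
  have hev : ∀ᶠ ε in 𝓝[>] (0 : ℝ), 0 < ε ∧ q ε ∈ cyclicPolytope3 t := by
    filter_upwards [Ioo_mem_nhdsGT (zero_lt_one (α := ℝ))] with ε hε
    exact ⟨hε.1, convex_convexHull ℝ _ (edgeMidpoint_mem t v w) hY (sub_nonneg.2 hε.2.le) hε.1.le
      (by ring)⟩
  -- Pigeonhole over finitely many tetrahedra: one of them contains points of the path arbitrarily
  -- close to the midpoint, hence by closedness the midpoint itself.
  have hfreq : ∃ S' : Finset (Fin m), S' ∈ T ∧
      ∃ᶠ ε in 𝓝[>] (0 : ℝ), q ε ∈ momentHull t (S' : Set (Fin m)) := by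
    by_contra! hcon
    have hall : ∀ᶠ ε in 𝓝[>] (0 : ℝ), ∀ S' : Finset (Fin m), S' ∈ T →
        q ε ∉ momentHull t (S' : Set (Fin m)) := by
      rw [eventually_all]
      intro S'
      by_cases h : S' ∈ T
      · filter_upwards [hcon S' h] with ε hε _
        exact hε
      · exact Eventually.of_forall fun ε h' => absurd h' h
    obtain ⟨ε, h1, _, h2⟩ := (hall.and hev).exists
    obtain ⟨S', hS', hmem⟩ := hT.exists_mem h2
    exact h1 S' hS' hmem
  obtain ⟨S', hS', hf⟩ := hfreq
  have hM : edgeMidpoint t v w ∈ momentHull t (S' : Set (Fin m)) :=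
    (isClosed_momentHull t _).mem_of_frequently_of_tendsto hf hq0
  have hMS : edgeMidpoint t v w ∈ momentHull t (S : Set (Fin m)) :=
    mem_momentHull_iff.2 ⟨_, (isMomentWeight_edgeMidpoint t).mono (by
      rintro i (rfl | rfl)
      · exact hv
      · exact hw)⟩
  have hMI : edgeMidpoint t v w ∈ momentHull t ((S : Set (Fin m)) ∩ (S' : Set (Fin m))) := by
    rw [← hT.inter S hS S' hS']
    exact ⟨hMS, hM⟩
  obtain ⟨hv', hw'⟩ := mem_of_edgeMidpoint_mem ht (hT.card_eq S hS).le hv hw hMI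
  obtain ⟨ε, hε, h1, _⟩ := (hf.and_eventually hev).exists
  exact ⟨S', hS', hv', hw', ε, h1, hε⟩

/-- For consecutive labels, (s - t i)(s - t j) is nonnegative at all parameters and vanishes only at
these two. Its mean at the midpoint is zero, so every weight of the midpoint is concentrated on `i`
and `j`. -/
theorem exists_mem_of_succ (hT : IsCyclicTriangulation t T) (ht : StrictMono t) {i j : Fin m}
    (hij : (i : ℕ) + 1 = j) : ∃ S ∈ T, i ∈ S ∧ j ∈ S := by
  obtain ⟨S, hS, hM⟩ := hT.exists_mem (edgeMidpoint_mem t i j)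
  refine ⟨S, hS, ?_⟩
  obtain ⟨lam, hl⟩ := mem_momentHull_iff.1 hM
  have hg : quadForm (edgeMidpoint t i j) (t i) (t j) = 0 := by
    rw [edgeMidpoint, quadForm_combo (by norm_num), quadForm_momentCurve, quadForm_momentCurve]
    ring
  have hpos : ∀ k, k ≠ i → k ≠ j → 0 < (t k - t i) * (t k - t j) := by
    intro k hi hj
    rcases lt_or_ge k i with h | h
    · have hkj : k < j := by omega
      exact mul_pos_of_neg_of_neg (sub_neg.2 (ht h)) (sub_neg.2 (ht hkj))
    · have hik : i < k := by omega
      have hkj : j < k := by omega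
      exact mul_pos (sub_pos.2 (ht hik)) (sub_pos.2 (ht hkj))
  have hnn : ∀ k, 0 ≤ lam k * ((t k - t i) * (t k - t j)) := by
    intro k
    refine mul_nonneg (hl.nonneg k) ?_
    by_cases h1 : k = i
    · simp [h1]
    by_cases h2 : k = j
    · simp [h2]
    exact (hpos k h1 h2).le
  have hz : ∀ k, k ≠ i → k ≠ j → lam k = 0 := by
    intro k h1 h2
    have h0 := (Finset.sum_eq_zero_iff_of_nonneg (fun k _ => hnn k)).1
      ((hl.sum_quad (t i) (t j)).trans hg) k (Finset.mem_univ k)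
    exact (mul_eq_zero.1 h0).resolve_right (hpos k h1 h2).ne'
  classical
  have hl' : IsMomentWeight t (({i, j} : Finset (Fin m)) : Set (Fin m)) (edgeMidpoint t i j)
      lam := by
    refine ⟨hl.nonneg, fun k hk => ?_, hl.sum_one, hl.moment⟩
    simp only [Finset.coe_insert, Finset.coe_singleton, Set.mem_insert_iff,
      Set.mem_singleton_iff, not_or] at hk
    exact hz k hk.1 hk.2
  refine mem_of_edgeMidpoint_mem ht (S := {i, j}) (S' := (S : Set (Fin m)))
    (Finset.card_le_two.trans (by norm_num)) (by simp) (by simp)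
    (mem_momentHull_iff.2 ⟨lam, hl.nonneg, fun k hk => ?_, hl.sum_one, hl.moment⟩)
  by_cases h : k ∈ (({i, j} : Finset (Fin m)) : Set (Fin m))
  · exact hl.support k fun h' => hk ⟨h, h'⟩
  · exact hl'.support k h

/-- If a segment is not an edge of a triangulation, it pierces a triangle of it. -/
theorem exists_mem_or_pierced (hT : IsCyclicTriangulation t T) (ht : StrictMono t)
    {a d : Fin m} (had : a < d) : ∃ S ∈ T, (a ∈ S ∧ d ∈ S) ∨
      ∃ x y z, x < a ∧ a < y ∧ y < d ∧ d < z ∧ x ∈ S ∧ y ∈ S ∧ z ∈ S := by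
  obtain ⟨S, hS, hM⟩ := hT.exists_mem (edgeMidpoint_mem t a d)
  refine ⟨S, hS, ?_⟩
  obtain ⟨lam, hl⟩ := mem_momentHull_iff.1 hM
  have hm := isMomentWeight_edgeMidpoint t (v := a) (w := d)
  set mu : Fin m → ℝ := fun i =>
    (Pi.single a (1 / 2) : Fin m → ℝ) i + (Pi.single d (1 / 2) : Fin m → ℝ) i with hmu
  have hpos : ∀ i, 0 < lam i - mu i → i ∈ S := by
    intro i hi
    by_contra hiS
    have := hl.support i (by simpa using hiS)
    have := hm.nonneg i
    linarith
  have hneg : ∀ i, lam i - mu i < 0 → i = a ∨ i = d := by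
    intro i hi
    by_contra hiS
    have := hm.support i (by simpa using hiS)
    have := hl.nonneg i
    linarith
  by_cases heq : lam = mu
  · left
    have hmem : ∀ i, 0 < mu i → i ∈ S := by
      intro i hi
      by_contra hiS
      exact hi.ne' (heq ▸ hl.support i (by simpa using hiS))
    constructor
    · refine hmem a ?_
      simp only [hmu, Pi.single_apply]
      split_ifs <;> norm_num at *
    · refine hmem d ?_
      simp only [hmu, Pi.single_apply]
      split_ifs <;> norm_num at *
  · right
    have hnu : (fun i => lam i - mu i) ≠ 0 := fun h0 =>
      heq (funext fun i => sub_eq_zero.1 (congrFun h0 i))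
    obtain ⟨x, b, y, c, z, hxb, hby, hyc, hcz, hs⟩ := (hl.sub hm).exists_alternation ht hnu
    -- Only `a` and `d` can be negative, so they are the second and fourth labels; the opposite
    -- pattern would need three negative labels.
    rcases hs with ⟨hx, hb, hy, hc, hz⟩ | ⟨hx, hb, hy, hc, hz⟩
    · have hb' := hneg b hb
      have hc' := hneg c hc
      exact ⟨x, y, z, by omega, by omega, by omega, by omega, hpos x hx, hpos y hy, hpos z hz⟩
    · have hx' := hneg x hx
      have hy' := hneg y hy
      have hz' := hneg z hz
      omega

/-- A triangle xyz pierced by ad is also pierced by ac if y < c, and by bd if c ≤ y; neither is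
allowed. -/
theorem exists_mem_of_crossing (hT : IsCyclicTriangulation t T) (ht : StrictMono t)
    {a b c d : Fin m} (hab : a < b) (hbc : b < c) (hcd : c < d) {S S' : Finset (Fin m)}
    (hS : S ∈ T) (hS' : S' ∈ T) (ha : a ∈ S) (hc : c ∈ S) (hb : b ∈ S') (hd : d ∈ S') :
    ∃ S ∈ T, a ∈ S ∧ d ∈ S := by
  obtain ⟨R, hR, h | ⟨x, y, z, hx, hy, hy', hz, hxR, hyR, hzR⟩⟩ :=
    hT.exists_mem_or_pierced ht (hab.trans (hbc.trans hcd))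
  · exact ⟨R, hR, h⟩
  · rcases lt_or_ge y c with h | h
    · exact absurd ⟨x, a, y, c, z, hx, hy, h, by omega, hxR, hyR, hzR, ha, hc⟩
        (hT.not_crosses ht hR hS)
    · exact absurd ⟨x, b, y, d, z, by omega, by omega, hy', hz, hxR, hyR, hzR, hb, hd⟩
        (hT.not_crosses ht hR hS')

theorem cubicForm_edgeMidpoint (t : Fin m → ℝ) (v w : Fin m) (x : ℝ) :
    cubicForm (edgeMidpoint t v w) (t v) (t w) x = 0 := by
  rw [edgeMidpoint, cubicForm_combo (by norm_num), cubicForm_momentCurve, cubicForm_momentCurve]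
  ring

/-- Moving from the midpoint of ab towards the point labelled `x` makes the mean of (s - t a)(s - t
b) negative, so the tetrahedron at ab entered in this direction has a vertex strictly between. -/
theorem exists_mem_between (hT : IsCyclicTriangulation t T) (ht : StrictMono t)
    {S : Finset (Fin m)} (hS : S ∈ T) {a b x : Fin m} (hax : a < x) (hxb : x < b) (ha : a ∈ S)
    (hb : b ∈ S) : ∃ y, a < y ∧ y < b ∧ ∃ S ∈ T, a ∈ S ∧ y ∈ S ∧ b ∈ S := by
  obtain ⟨S', hS', ha', hb', ε, hε, hmem⟩ := hT.exists_mem_near_edge ht hS ha hb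
    (momentCurve_mem_momentHull t (Set.mem_univ x))
  by_contra! hcon
  obtain ⟨lam, hl⟩ := mem_momentHull_iff.1 hmem
  have h0 := hl.quadForm_nonneg (a := t a) (b := t b) (by
    intro i hi
    rcases le_or_gt i a with h | h
    · exact mul_nonneg_of_nonpos_of_nonpos (sub_nonpos.2 (ht.monotone h))
        (sub_nonpos.2 (ht.monotone (by omega)))
    rcases lt_or_ge i b with h' | h'
    · exact absurd hb' (hcon i h h' S' hS' ha' hi)
    · exact mul_nonneg (sub_nonneg.2 (ht.monotone h.le)) (sub_nonneg.2 (ht.monotone h')))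
  have hM : quadForm (edgeMidpoint t a b) (t a) (t b) = 0 := by
    rw [edgeMidpoint, quadForm_combo (by norm_num), quadForm_momentCurve, quadForm_momentCurve]
    ring
  rw [quadForm_combo (by ring), hM, quadForm_momentCurve, mul_zero, zero_add] at h0
  have := mul_pos hε (mul_pos (sub_pos.2 (ht hax)) (sub_pos.2 (ht hxb)))
  nlinarith

/-- Leave the midpoint of vw towards a point Y of the segment pq at which (s - v)²(s - w) has
positive and (s - v)(s - w)² negative mean. The first excludes a tetrahedron with no vertex after
`w`, the second one with no vertex before `v`. -/
theorem exists_middle_edge (hT : IsCyclicTriangulation t T) (ht : StrictMono t)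
    {S : Finset (Fin m)} (hS : S ∈ T) {p v w q : Fin m} (hpv : p < v) (hvw : v < w) (hwq : w < q)
    (hv : v ∈ S) (hw : w ∈ S) :
    ∃ S ∈ T, v ∈ S ∧ w ∈ S ∧ (∃ x ∈ S, x < v) ∧ ∃ y ∈ S, w < y := by
  obtain ⟨A, hA⟩ : ∃ A, A = t v - t p := ⟨_, rfl⟩
  obtain ⟨A', hA'⟩ : ∃ A', A' = t w - t p := ⟨_, rfl⟩
  obtain ⟨B, hB⟩ : ∃ B, B = t q - t v := ⟨_, rfl⟩
  obtain ⟨B', hB'⟩ : ∃ B', B' = t q - t w := ⟨_, rfl⟩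
  have pA : 0 < A := hA ▸ sub_pos.2 (ht hpv)
  have pB' : 0 < B' := hB' ▸ sub_pos.2 (ht hwq)
  have hAA : A < A' := by
    have := ht hvw
    linarith
  have hBB : B' < B := by
    have := ht hvw
    linarith
  have pA' : 0 < A' := pA.trans hAA
  have pB : 0 < B := pB'.trans hBB
  have hcross : A * B' < A' * B := mul_lt_mul'' hAA hBB pA.le pB'.le
  -- With these masses at `p` and `q`, the numerators of the two means become A'B - AB' and AB' -
  -- A'B, so `hcross` settles both signs.
  set α := (B + B') / (A * A') with hα
  set β := (A + A') / (B * B') with hβ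
  have pα : 0 < α := by positivity
  have pβ : 0 < β := by positivity
  have eα : α * (A * A') = B + B' := by rw [hα]; field_simp
  have eβ : β * (B * B') = A + A' := by rw [hβ]; field_simp
  have hsum : α / (α + β) + β / (α + β) = 1 := by field_simp
  set Y := (α / (α + β)) • momentCurve 3 (t p) + (β / (α + β)) • momentCurve 3 (t q) with hY
  have hYC : Y ∈ cyclicPolytope3 t := convex_convexHull ℝ _
    (momentCurve_mem_momentHull t (Set.mem_univ p)) (momentCurve_mem_momentHull t (Set.mem_univ q))
    (by positivity) (by positivity) hsum
  have hY1 : 0 < cubicForm Y (t v) (t w) (t v) := by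
    rw [hY, cubicForm_combo hsum, cubicForm_momentCurve, cubicForm_momentCurve]
    have : α / (α + β) * ((t p - t v) * (t p - t w) * (t p - t v)) +
        β / (α + β) * ((t q - t v) * (t q - t w) * (t q - t v)) =
        (β * (B * B') * B - α * (A * A') * A) / (α + β) := by
      rw [hA, hA', hB, hB']
      ring
    rw [this, eα, eβ]
    refine div_pos ?_ (by positivity)
    linarith
  have hY2 : cubicForm Y (t v) (t w) (t w) < 0 := by
    rw [hY, cubicForm_combo hsum, cubicForm_momentCurve, cubicForm_momentCurve]
    have : α / (α + β) * ((t p - t v) * (t p - t w) * (t p - t w)) +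
        β / (α + β) * ((t q - t v) * (t q - t w) * (t q - t w)) =
        (β * (B * B') * B' - α * (A * A') * A') / (α + β) := by
      rw [hA, hA', hB, hB']
      ring
    rw [this, eα, eβ]
    refine div_neg_of_neg_of_pos ?_ (by positivity)
    linarith
  obtain ⟨S', hS', hv', hw', ε, hε, hmem⟩ := hT.exists_mem_near_edge ht hS hv hw hYC
  obtain ⟨lam, hl⟩ := mem_momentHull_iff.1 hmem
  refine ⟨S', hS', hv', hw', ?_, ?_⟩
  · by_contra! hcon
    have h0 := hl.cubicForm_nonneg (a := t v) (b := t w) (c := t w) (by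
      intro i hi
      rw [mul_assoc]
      exact mul_nonneg (sub_nonneg.2 (ht.monotone (hcon i hi))) (mul_self_nonneg _))
    rw [cubicForm_combo (by ring), cubicForm_edgeMidpoint, mul_zero, zero_add] at h0
    nlinarith
  · by_contra! hcon
    have h0 := hl.cubicForm_nonpos (a := t v) (b := t w) (c := t v) (by
      intro i hi
      have h1 := mul_self_nonneg (t i - t v)
      have h2 := sub_nonpos.2 (ht.monotone (hcon i hi))
      nlinarith [mul_nonneg h1 (neg_nonneg.2 h2)])
    rw [cubicForm_combo (by ring), cubicForm_edgeMidpoint, mul_zero, zero_add] at h0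
    nlinarith

end IsCyclicTriangulation

/-! ### The cone over a persistent graph -/

/-- A persistent graph in which the first and the last vertex are joined to all others. -/
structure IsConePersistent (H : SimpleGraph (Fin (n + 2))) : Prop extends IsPersistent H where
  adj_zero : ∀ x, 0 < x → H.Adj 0 x
  adj_last : ∀ x, x < Fin.last (n + 1) → H.Adj x (Fin.last (n + 1))

theorem innerVertex_lt_iff {i j : Fin n} : innerVertex i < innerVertex j ↔ i < j := by
  simp [innerVertex]

theorem innerVertex_injective : Function.Injective (innerVertex (n := n)) := fun i j h => by
  simpa [innerVertex] using h

@[simp]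
theorem val_innerVertex (i : Fin n) : (innerVertex i : ℕ) = i + 1 := by
  simp [innerVertex]

theorem exists_innerVertex_eq {x y z : Fin (n + 2)} (h : x < y) (h' : y < z) :
    ∃ i : Fin n, innerVertex i = y :=
  ⟨⟨y - 1, by omega⟩, by ext; simp; omega⟩

theorem hatGraph_adj_innerVertex (G : SimpleGraph (Fin n)) {i j : Fin n} :
    (hatGraph G).Adj (innerVertex i) (innerVertex j) ↔ G.Adj i j := by
  have h0 : ∀ k : Fin n, innerVertex k ≠ 0 := fun k => (zero_lt_innerVertex k).ne'
  have hl : ∀ k : Fin n, innerVertex k ≠ Fin.last (n + 1) := fun k => (innerVertex_lt_last k).ne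
  simp only [hatGraph, SimpleGraph.fromRel_adj, h0, hl, false_or]
  constructor
  · rintro ⟨_, ⟨a, b, hab, ha, hb⟩ | ⟨a, b, hab, ha, hb⟩⟩
    · rwa [innerVertex_injective ha, innerVertex_injective hb]
    · rw [innerVertex_injective ha, innerVertex_injective hb]
      exact hab.symm
  · intro h
    exact ⟨fun h' => h.ne (innerVertex_injective h'), Or.inl ⟨i, j, h, rfl, rfl⟩⟩

theorem hatGraph_zero_adj (G : SimpleGraph (Fin n)) {x : Fin (n + 2)} (hx : 0 < x) :
    (hatGraph G).Adj 0 x :=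
  ⟨hx.ne, Or.inl (Or.inl rfl)⟩

theorem hatGraph_adj_last' (G : SimpleGraph (Fin n)) {x : Fin (n + 2)}
    (hx : x < Fin.last (n + 1)) : (hatGraph G).Adj x (Fin.last (n + 1)) :=
  ⟨hx.ne, Or.inr (Or.inr (Or.inl rfl))⟩

theorem IsPersistent.hatGraph {G : SimpleGraph (Fin n)} (hG : IsPersistent G) :
    IsConePersistent (hatGraph G) where
  adj_zero _ h := hatGraph_zero_adj G h
  adj_last _ h := hatGraph_adj_last' G h
  hamilton i j hij := by
    rcases eq_or_ne i 0 with rfl | hi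
    · exact hatGraph_zero_adj G (by rw [Fin.lt_def]; omega)
    rcases eq_or_ne j (Fin.last (n + 1)) with rfl | hj
    · exact hatGraph_adj_last' G (by rw [Fin.lt_def]; omega)
    have hi' : 0 < i := Fin.pos_iff_ne_zero.2 hi
    have hj' : j < Fin.last (n + 1) := Fin.lt_last_iff_ne_last.2 hj
    obtain ⟨a, rfl⟩ := exists_innerVertex_eq hi' (show i < j by omega)
    obtain ⟨b, rfl⟩ := exists_innerVertex_eq (show innerVertex a < j by omega) hj'
    exact (hatGraph_adj_innerVertex G).2 (hG.hamilton a b (by simpa using hij))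
  xProperty a b c d hab hbc hcd hac hbd := by
    rcases eq_or_ne a 0 with rfl | ha
    · exact hatGraph_zero_adj G (hab.trans (hbc.trans hcd))
    rcases eq_or_ne d (Fin.last (n + 1)) with rfl | hd
    · exact hatGraph_adj_last' G (hab.trans (hbc.trans hcd))
    obtain ⟨b, rfl⟩ := exists_innerVertex_eq hab hbc
    obtain ⟨c, rfl⟩ := exists_innerVertex_eq hbc hcd
    obtain ⟨a, rfl⟩ := exists_innerVertex_eq (Fin.pos_iff_ne_zero.2 ha) hab
    obtain ⟨d, rfl⟩ := exists_innerVertex_eq hcd (Fin.lt_last_iff_ne_last.2 hd)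
    rw [hatGraph_adj_innerVertex] at hac hbd ⊢
    rw [innerVertex_lt_iff] at hab hbc hcd
    exact hG.xProperty a b c d hab hbc hcd hac hbd
  barProperty a b hab hlt := by
    rcases eq_or_ne b (Fin.last (n + 1)) with rfl | hb
    · have hlast : (a : ℕ) + 1 < n + 1 := by simpa using hlt
      -- An edge at a cone vertex gets its intermediate vertex from the Hamilton path: the successor
      -- of `a` here, the predecessor of `b` when `a` is 0.
      refine ⟨⟨a + 1, by omega⟩, by rw [Fin.lt_def]; simp, by rw [Fin.lt_def]; simpa using hlast,
        ?_, hatGraph_adj_last' G (by rw [Fin.lt_def]; simpa using hlast)⟩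
      rcases eq_or_ne a 0 with rfl | ha
      · exact hatGraph_zero_adj G (by rw [Fin.lt_def]; simp)
      · obtain ⟨i, hi⟩ := exists_innerVertex_eq (Fin.pos_iff_ne_zero.2 ha)
          (show a < Fin.last (n + 1) by rw [Fin.lt_def]; simp; omega)
        have hi' : (i : ℕ) + 1 = a := by simp [← hi]
        have hj : innerVertex (⟨i + 1, by omega⟩ : Fin n) = ⟨a + 1, by omega⟩ := by
          ext
          simp
          omega
        have := (hatGraph_adj_innerVertex G).2 (hG.hamilton i ⟨i + 1, by omega⟩ rfl)
        rwa [hj, hi] at this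
    rcases eq_or_ne a 0 with rfl | ha
    · have h1 : 1 < (b : ℕ) := by simpa using hlt
      have h2 : (b : ℕ) < n + 1 := by
        have := b.2
        have h3 : (b : ℕ) ≠ n + 1 := fun h => hb (Fin.ext (by simpa using h))
        omega
      have hi : innerVertex (⟨b - 2, by omega⟩ : Fin n) = ⟨b - 1, by omega⟩ := by
        ext
        simp
        omega
      have hj : innerVertex (⟨b - 1, by omega⟩ : Fin n) = b := by
        ext
        simp
        omega
      refine ⟨⟨b - 1, by omega⟩, by rw [Fin.lt_def]; simp; omega, by rw [Fin.lt_def]; simp; omega,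
        hatGraph_zero_adj G (by rw [Fin.lt_def]; simp; omega), ?_⟩
      have := (hatGraph_adj_innerVertex G).2 (hG.hamilton ⟨b - 2, by omega⟩ ⟨b - 1, by omega⟩
        (by simp; omega))
      rwa [hi, hj] at this
    · obtain ⟨i, rfl⟩ := exists_innerVertex_eq (Fin.pos_iff_ne_zero.2 ha) (show a < b by omega)
      obtain ⟨j, rfl⟩ := exists_innerVertex_eq (show innerVertex i < b by omega)
        (Fin.lt_last_iff_ne_last.2 hb)
      rw [hatGraph_adj_innerVertex] at hab
      obtain ⟨x, h1, h2, h3, h4⟩ := hG.barProperty i j hab (by simpa using hlt)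
      exact ⟨innerVertex x, innerVertex_lt_iff.2 h1, innerVertex_lt_iff.2 h2,
        (hatGraph_adj_innerVertex G).2 h3, (hatGraph_adj_innerVertex G).2 h4⟩

/-! ### Tetrahedra and uncrossed triangles of a cone graph -/

/-- The tetrahedron on `l < v < w < r` is the one assigned to the edge between `v` and `w`. -/
structure IsXi (H : SimpleGraph (Fin (n + 2))) (l v w r : Fin (n + 2)) : Prop where
  lv : l < v
  vw : v < w
  wr : w < r
  adj_vw : H.Adj v w
  adj_lw : H.Adj l w
  adj_vr : H.Adj v r
  left_max : ∀ i, l < i → i < v → ¬ H.Adj i w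
  right_min : ∀ i, w < i → i < r → ¬ H.Adj v i

/-- A triangle of edges that is not crossed by any edge. -/
structure IsFace (H : SimpleGraph (Fin (n + 2))) (x y z : Fin (n + 2)) : Prop where
  xy : x < y
  yz : y < z
  adj_xy : H.Adj x y
  adj_yz : H.Adj y z
  adj_xz : H.Adj x z
  not_crossed : ∀ b d, x < b → b < y → y < d → d < z → ¬ H.Adj b d

namespace IsConePersistent

variable {H : SimpleGraph (Fin (n + 2))} {l v w r x y z : Fin (n + 2)}

theorem exists_isXi (hH : IsConePersistent H) (hv : 0 < v) (hvw : v < w)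
    (hw : w < Fin.last (n + 1)) (h : H.Adj v w) : ∃ l r, IsXi H l v w r := by
  obtain ⟨l, ⟨hlv, hlw⟩, hl⟩ := exists_greatest_of_exists
    (P := fun i => i < v ∧ H.Adj i w) ⟨0, hv, hH.adj_zero w (hv.trans hvw)⟩
  obtain ⟨r, ⟨hwr, hvr⟩, hr⟩ := exists_least_of_exists
    (P := fun i => w < i ∧ H.Adj v i) ⟨_, hw, hH.adj_last v (hvw.trans hw)⟩
  exact ⟨l, r, hlv, hvw, hwr, h, hlw, hvr, fun i h1 h2 h3 => hl i h1 ⟨h2, h3⟩,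
    fun i h1 h2 h3 => hr i h2 ⟨h1, h3⟩⟩

/-- Let x be the least neighbour of `l` in [v, w]. If x ≠ v, the bar property of lx gives a vertex
y: beyond `v` it contradicts the choice of x, and before `v` it is adjacent to `w`, by the
X-property if x < w, against the choice of `l`. -/
theorem adj_left (hH : IsConePersistent H) (h : IsXi H l v w r) : H.Adj l v := by
  obtain ⟨x, ⟨hvx, hxw, hlx⟩, hmin⟩ := exists_least_of_exists
    (P := fun i => v ≤ i ∧ i ≤ w ∧ H.Adj l i) ⟨w, h.vw.le, le_rfl, h.adj_lw⟩
  rcases hvx.eq_or_lt with rfl | hvx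
  · exact hlx
  exfalso
  have := h.lv
  obtain ⟨y, hly, hyx, h1, h2⟩ := hH.barProperty l x hlx (by omega)
  rcases lt_or_ge y v with hy | hy
  · refine h.left_max y hly hy ?_
    rcases hxw.eq_or_lt with rfl | hxw
    · exact h2
    · exact hH.xProperty y v x w hy hvx hxw h2 h.adj_vw
  · exact hmin y hyx ⟨hy, by omega, h1⟩

theorem adj_right (hH : IsConePersistent H) (h : IsXi H l v w r) : H.Adj w r := by
  obtain ⟨x, ⟨hvx, hxw, hxr⟩, hmax⟩ := exists_greatest_of_exists
    (P := fun i => v ≤ i ∧ i ≤ w ∧ H.Adj i r) ⟨v, le_rfl, h.vw.le, h.adj_vr⟩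
  rcases hxw.eq_or_lt with rfl | hxw
  · exact hxr
  exfalso
  have := h.wr
  obtain ⟨y, hxy, hyr, h1, h2⟩ := hH.barProperty x r hxr (by omega)
  rcases lt_or_ge w y with hy | hy
  · refine h.right_min y hy hyr ?_
    rcases hvx.eq_or_lt with rfl | hvx
    · exact h1
    · exact hH.xProperty v x w y hvx hxw hy h.adj_vw h1
  · exact hmax y hxy ⟨by omega, hy, h2⟩

theorem adj_outer (hH : IsConePersistent H) (h : IsXi H l v w r) : H.Adj l r :=
  hH.xProperty l v w r h.lv h.vw h.wr h.adj_lw h.adj_vr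

/-- The middle edge of a tetrahedron is the only edge above it within the outer vertices. -/
theorem not_adj_around (hH : IsConePersistent H) (h : IsXi H l v w r) {b d : Fin (n + 2)}
    (hlb : l < b) (hbv : b ≤ v) (hwd : w ≤ d) (hdr : d < r) (hne : b ≠ v ∨ d ≠ w) :
    ¬ H.Adj b d := by
  intro hbd
  rcases hbv.eq_or_lt with rfl | hb
  · exact h.right_min d (by omega) hdr hbd
  rcases hwd.eq_or_lt with rfl | hd
  · exact h.left_max b hlb hb hbd
  have := h.vw
  -- Outside the open interval from `v` to `w`, the vertex `x` gives a shorter edge of the same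
  -- kind; inside it, the X-property gives an edge bw that contradicts the maximality of `l`.
  obtain ⟨x, hbx, hxd, h1, h2⟩ := hH.barProperty b d hbd (by omega)
  rcases le_or_gt x v with hx | hx
  · exact not_adj_around hH h (by omega) hx hwd hdr (Or.inr hd.ne') h2
  rcases lt_or_ge x w with hx' | hx'
  · exact h.left_max b hlb hb (hH.xProperty b v x w hb hx hx' h1 h.adj_vw)
  · exact not_adj_around hH h hlb hbv hx' (by omega) (Or.inl hb.ne) h1
termination_by (d : ℕ) - b

/-- An edge bd starting after `v` or ending before `w` combines with vw by the X-property, against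
the choice of `r` or `l`. Otherwise it spans vw, and it is not vw itself because a vertex of the
tetrahedron lies strictly inside it. -/
theorem not_adj_of_crossed (hH : IsConePersistent H) (h : IsXi H l v w r)
    (hx : x = l ∨ x = v ∨ x = w ∨ x = r) (hy : y = l ∨ y = v ∨ y = w ∨ y = r)
    (hz : z = l ∨ z = v ∨ z = w ∨ z = r) {b d : Fin (n + 2)} (hxb : x < b) (hby : b < y)
    (hyd : y < d) (hdz : d < z) : ¬ H.Adj b d := by
  intro hbd
  have h1 := h.lv
  have h2 := h.vw
  have h3 := h.wr
  rcases lt_or_ge v b with hvb | hbv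
  · have hyw : y = w := by omega
    have hzr : z = r := by omega
    rw [hyw] at hby hyd
    rw [hzr] at hdz
    exact h.right_min d hyd hdz (hH.xProperty v b w d hvb hby hyd h.adj_vw hbd)
  rcases lt_or_ge d w with hdw | hwd
  · have hyv : y = v := by omega
    have hxl : x = l := by omega
    rw [hyv] at hby hyd
    rw [hxl] at hxb
    exact h.left_max b hxb hby (hH.xProperty b v d w hby hyd hdw hbd h.adj_vw)
  · exact hH.not_adj_around h (by omega) hbv hwd (by omega) (by omega) hbd

theorem isFace_of_isXi_lvr (hH : IsConePersistent H) (h : IsXi H l v w r) : IsFace H l v r :=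
  ⟨h.lv, h.vw.trans h.wr, hH.adj_left h, h.adj_vr, hH.adj_outer h, fun _ _ h1 h2 h3 h4 =>
    hH.not_adj_of_crossed h (by simp) (by simp) (by simp) h1 h2 h3 h4⟩

theorem isFace_of_isXi_vwr (hH : IsConePersistent H) (h : IsXi H l v w r) : IsFace H v w r :=
  ⟨h.vw, h.wr, h.adj_vw, hH.adj_right h, h.adj_vr, fun _ _ h1 h2 h3 h4 =>
    hH.not_adj_of_crossed h (by simp) (by simp) (by simp) h1 h2 h3 h4⟩

/-- Every face is an upper facet of the polytope or a lower facet of a tetrahedron. -/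
theorem exists_isXi_above (hH : IsConePersistent H) (h : IsFace H x y z) :
    ((x : ℕ) + 1 = y ∧ z = Fin.last (n + 1)) ∨ (∃ u, IsXi H x y z u) ∨ ∃ u, IsXi H x u y z := by
  have hxy := h.xy
  have hyz := h.yz
  -- In this case `x` is the left vertex of the edge yz. Otherwise the tetrahedron above has a
  -- middle edge uy with u between `x` and `y`.
  by_cases hstart : z ≠ Fin.last (n + 1) ∧ ∀ i, x < i → i < y → ¬ H.Adj i z
  · right; left
    obtain ⟨l, r, hX⟩ := hH.exists_isXi (v := y) (w := z) ((Fin.zero_le x).trans_lt hxy) hyz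
      (Fin.lt_last_iff_ne_last.2 hstart.1) h.adj_yz
    obtain rfl : l = x := by
      have := hX.lv
      rcases lt_trichotomy l x with h1 | h1 | h1
      · exact absurd h.adj_xz (hX.left_max x h1 hxy)
      · exact h1
      · exact absurd hX.adj_lw (hstart.2 l h1 this)
    exact ⟨r, hX⟩
  by_cases hend : (x : ℕ) + 1 = y ∧ z = Fin.last (n + 1)
  · exact Or.inl hend
  right; right
  have hex : ∃ i, x < i ∧ i < y ∧ H.Adj i z := by
    by_cases hz : z = Fin.last (n + 1)
    · subst hz
      refine ⟨⟨x + 1, by omega⟩, by rw [Fin.lt_def]; simp, by rw [Fin.lt_def]; simp; omega,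
        hH.adj_last _ (by rw [Fin.lt_def]; simp; omega)⟩
    · by_contra! hcon
      exact hstart ⟨hz, hcon⟩
  have hcommon : ∃ i, x < i ∧ i < y ∧ H.Adj i y ∧ H.Adj i z := by
    obtain ⟨i, ⟨hxi, hiy, hiz⟩, hmax⟩ := exists_greatest_of_exists hex
    refine ⟨i, hxi, hiy, ?_, hiz⟩
    -- The vertex `k` can only be `y`: before `y` it beats the maximality of `i`, and after `y` the
    -- edge ik crosses the face.
    obtain ⟨k, hik, hkz, h1, h2⟩ := hH.barProperty i z hiz (by omega)
    rcases lt_trichotomy k y with h3 | h3 | h3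
    · exact absurd ⟨by omega, h3, h2⟩ (hmax k hik)
    · exact h3 ▸ h1
    · exact absurd h1 (h.not_crossed i k hxi hiy h3 hkz)
  obtain ⟨u, ⟨hxu, huy, huy', huz⟩, hmin⟩ := exists_least_of_exists hcommon
  refine ⟨u, hxu, huy, hyz, huy', h.adj_xy, huz, fun i h1 h2 h3 => ?_, fun i h1 h2 h3 =>
    h.not_crossed u i hxu huy h1 h2 h3⟩
  -- A neighbour of `y` between `x` and `u` would, by the X-property, also be a neighbour of `z`,
  -- against the minimality of `u`.
  exact hmin i h2 ⟨h1, by omega, h3, hH.xProperty i u y z h2 huy hyz h3 huz⟩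

end IsConePersistent

/-! ### Ξ in terms of the cone graph -/

theorem leftVertex_eq_iff (G : SimpleGraph (Fin n)) {v w : Fin n} {l : Fin (n + 2)} :
    leftVertex G v w = l ↔ l < innerVertex v ∧ (hatGraph G).Adj l (innerVertex w) ∧
      ∀ i, l < i → i < innerVertex v → ¬ (hatGraph G).Adj i (innerVertex w) := by
  refine (Finset.max'_eq_iff _ _ _).trans ?_
  simp only [Finset.mem_filter, Finset.mem_univ, true_and, and_imp]
  constructor
  · rintro ⟨⟨h1, h2⟩, h3⟩
    exact ⟨h1, h2, fun i hi h4 h5 => absurd (h3 i h4 h5) hi.not_ge⟩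
  · rintro ⟨h1, h2, h3⟩
    exact ⟨⟨h1, h2⟩, fun i h4 h5 => not_lt.1 fun hi => h3 i hi h4 h5⟩

theorem rightVertex_eq_iff (G : SimpleGraph (Fin n)) {v w : Fin n} {r : Fin (n + 2)} :
    rightVertex G v w = r ↔ innerVertex w < r ∧ (hatGraph G).Adj (innerVertex v) r ∧
      ∀ i, innerVertex w < i → i < r → ¬ (hatGraph G).Adj (innerVertex v) i := by
  refine (Finset.min'_eq_iff _ _ _).trans ?_
  simp only [Finset.mem_filter, Finset.mem_univ, true_and, and_imp]
  constructor
  · rintro ⟨⟨h1, h2⟩, h3⟩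
    exact ⟨h1, h2.symm, fun i h4 hi h5 => absurd (h3 i h4 h5.symm) hi.not_ge⟩
  · rintro ⟨h1, h2, h3⟩
    exact ⟨⟨h1, h2.symm⟩, fun i h4 h5 => not_lt.1 fun hi => h3 i h4 hi h5.symm⟩

theorem mem_XiMap_iff (G : SimpleGraph (Fin n)) {S : Finset (Fin (n + 2))} :
    S ∈ XiMap G ↔ ∃ l v w r, IsXi (hatGraph G) l v w r ∧ S = {l, v, w, r} := by
  constructor
  · rintro ⟨v, w, hvw, hadj, rfl⟩
    obtain ⟨h1, h2, h3⟩ := (leftVertex_eq_iff G (v := v) (w := w)).1 rfl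
    obtain ⟨h4, h5, h6⟩ := (rightVertex_eq_iff G (v := v) (w := w)).1 rfl
    exact ⟨_, _, _, _, ⟨h1, innerVertex_lt_iff.2 hvw, h4, (hatGraph_adj_innerVertex G).2 hadj, h2,
      h5, h3, h6⟩, rfl⟩
  · rintro ⟨l, v, w, r, h, rfl⟩
    obtain ⟨v, rfl⟩ := exists_innerVertex_eq h.lv h.vw
    obtain ⟨w, rfl⟩ := exists_innerVertex_eq h.vw h.wr
    refine ⟨v, w, innerVertex_lt_iff.1 h.vw, (hatGraph_adj_innerVertex G).1 h.adj_vw, ?_⟩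
    rw [xiSimplex, (leftVertex_eq_iff G).2 ⟨h.lv, h.adj_lw, h.left_max⟩,
      (rightVertex_eq_iff G).2 ⟨h.wr, h.adj_vr, h.right_min⟩]

/-! ### Covering of generic points by climbing through faces -/

/-- The cubic forms are vertical heights above facet planes, and heights above two facets with a
common edge differ by a multiple of the quadratic form of that edge. The form of bd, shared by the
upper facets abd and bcd, decides which of them `X` projects to. Then `X` is in the tetrahedron or
above that facet, at smaller height. -/
theorem climb_last {X : Fin 3 → ℝ} {a b c d : ℝ} (hab : a < b) (hbc : b < c) (hcd : c < d)
    (h1 : 0 < quadForm X a b) (h2 : quadForm X a c < 0) (h3 : 0 < quadForm X b c)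
    (hF : 0 < cubicForm X a b c) (hne : quadForm X b d ≠ 0) :
    (0 ≤ cubicForm X a c d ∧ cubicForm X a b d ≤ 0 ∧ cubicForm X b c d ≤ 0) ∨
      (0 < cubicForm X a b d ∧ cubicForm X a b d < cubicForm X a b c ∧
        quadForm X a d < 0 ∧ 0 < quadForm X b d) ∨
      (0 < cubicForm X b c d ∧ cubicForm X b c d < cubicForm X a b c ∧
        quadForm X b d < 0 ∧ 0 < quadForm X c d) := by
  have e1 : cubicForm X a b d = cubicForm X a b c - (d - c) * quadForm X a b := by
    simp only [cubicForm, quadForm]; ring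
  have e2 : cubicForm X a c d = cubicForm X a b c - (d - b) * quadForm X a c := by
    simp only [cubicForm, quadForm]; ring
  have e3 : cubicForm X b c d = cubicForm X a b c - (d - a) * quadForm X b c := by
    simp only [cubicForm, quadForm]; ring
  have e4 : cubicForm X b c d = cubicForm X a b d - (c - a) * quadForm X b d := by
    simp only [cubicForm, quadForm]; ring
  have e5 : quadForm X a d = quadForm X a c - (d - c) * (X 0 - a) := by
    simp only [quadForm]; ring
  have e6 : quadForm X c d = quadForm X b c + (d - b) * (c - X 0) := by
    simp only [quadForm]; ring
  have m1 : 0 < X 0 - a := by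
    have : quadForm X a b - quadForm X a c = (c - b) * (X 0 - a) := by
      simp only [quadForm]; ring
    exact pos_of_mul_pos_right (this ▸ by linarith) (sub_pos.2 hbc).le
  have m2 : 0 < c - X 0 := by
    have : quadForm X b c - quadForm X a c = (b - a) * (c - X 0) := by
      simp only [quadForm]; ring
    exact pos_of_mul_pos_right (this ▸ by linarith) (sub_pos.2 hab).le
  have p1 : 0 < (d - c) * quadForm X a b := mul_pos (by linarith) h1
  have p2 : (d - b) * quadForm X a c < 0 := mul_neg_of_pos_of_neg (by linarith) h2
  have p3 : 0 < (d - a) * quadForm X b c := mul_pos (by linarith) h3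
  have p5 : 0 < (d - c) * (X 0 - a) := mul_pos (by linarith) m1
  have p6 : 0 < (d - b) * (c - X 0) := mul_pos (by linarith) m2
  rcases lt_or_gt_of_ne hne with h | h
  · have p4 : (c - a) * quadForm X b d < 0 := mul_neg_of_pos_of_neg (by linarith) h
    rcases le_or_gt (cubicForm X b c d) 0 with h' | h'
    · left
      exact ⟨by linarith, by linarith, h'⟩
    · right; right
      exact ⟨h', by linarith, h, by linarith⟩
  · have p4 : 0 < (c - a) * quadForm X b d := mul_pos (by linarith) h
    rcases le_or_gt (cubicForm X a b d) 0 with h' | h'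
    · left
      exact ⟨by linarith, h', by linarith⟩
    · right; left
      exact ⟨h', by linarith, by linarith, h⟩

/-- The same step when the new vertex lies inside the face: the upper facets are auc and ubc, with
common edge uc. -/
theorem climb_middle {X : Fin 3 → ℝ} {a u b c : ℝ} (hau : a < u) (hub : u < b) (hbc : b < c)
    (h1 : 0 < quadForm X a b) (h2 : quadForm X a c < 0) (h3 : 0 < quadForm X b c)
    (hF : 0 < cubicForm X a b c) (hne : quadForm X u c ≠ 0) :
    (0 ≤ cubicForm X a u b ∧ cubicForm X a u c ≤ 0 ∧ cubicForm X u b c ≤ 0) ∨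
      (0 < cubicForm X a u c ∧ cubicForm X a u c < cubicForm X a b c ∧
        0 < quadForm X a u ∧ 0 < quadForm X u c) ∨
      (0 < cubicForm X u b c ∧ cubicForm X u b c < cubicForm X a b c ∧
        0 < quadForm X u b ∧ quadForm X u c < 0) := by
  have e1 : cubicForm X a u b = cubicForm X a b c + (c - u) * quadForm X a b := by
    simp only [cubicForm, quadForm]; ring
  have e2 : cubicForm X a u c = cubicForm X a b c + (b - u) * quadForm X a c := by
    simp only [cubicForm, quadForm]; ring
  have e3 : cubicForm X u b c = cubicForm X a b c - (u - a) * quadForm X b c := by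
    simp only [cubicForm, quadForm]; ring
  have e4 : cubicForm X u b c = cubicForm X a u c - (b - a) * quadForm X u c := by
    simp only [cubicForm, quadForm]; ring
  have e5 : quadForm X a u = quadForm X a b + (b - u) * (X 0 - a) := by
    simp only [quadForm]; ring
  have e6 : quadForm X u b = quadForm X a b + (u - a) * (b - X 0) := by
    simp only [quadForm]; ring
  have e7 : quadForm X u b = quadForm X b c + (c - u) * (X 0 - b) := by
    simp only [quadForm]; ring
  have m1 : 0 < X 0 - a := by
    have : quadForm X a b - quadForm X a c = (c - b) * (X 0 - a) := by
      simp only [quadForm]; ring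
    exact pos_of_mul_pos_right (this ▸ by linarith) (sub_pos.2 hbc).le
  have p1 : 0 < (c - u) * quadForm X a b := mul_pos (by linarith) h1
  have p2 : (b - u) * quadForm X a c < 0 := mul_neg_of_pos_of_neg (by linarith) h2
  have p3 : 0 < (u - a) * quadForm X b c := mul_pos (by linarith) h3
  have p5 : 0 < (b - u) * (X 0 - a) := mul_pos (by linarith) m1
  have p6 : 0 < quadForm X u b := by
    rcases le_total (X 0) b with h | h
    · have : 0 ≤ (u - a) * (b - X 0) := mul_nonneg (by linarith) (by linarith)
      linarith
    · have : 0 ≤ (c - u) * (X 0 - b) := mul_nonneg (by linarith) (by linarith)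
      linarith
  rcases lt_or_gt_of_ne hne with h | h
  · have p4 : (b - a) * quadForm X u c < 0 := mul_neg_of_pos_of_neg (by linarith) h
    rcases le_or_gt (cubicForm X u b c) 0 with h' | h'
    · left
      exact ⟨by linarith, by linarith, h'⟩
    · right; right
      exact ⟨h', by linarith, p6, h⟩
  · have p4 : 0 < (b - a) * quadForm X u c := mul_pos (by linarith) h
    rcases le_or_gt (cubicForm X a u c) 0 with h' | h'
    · left
      exact ⟨by linarith, h', by linarith⟩
    · right; left
      exact ⟨h', by linarith, by linarith, h⟩

theorem IsMomentWeight.quadForm_succ_nonneg {m : ℕ} {t : Fin m → ℝ} (ht : StrictMono t)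
    {X : Fin 3 → ℝ} {lam : Fin m → ℝ} (h : IsMomentWeight t Set.univ X lam) {i j : Fin m}
    (hij : (i : ℕ) + 1 = j) : 0 ≤ quadForm X (t i) (t j) := by
  refine h.quadForm_nonneg fun k _ => ?_
  rcases le_or_gt k i with hk | hk
  · exact mul_nonneg_of_nonpos_of_nonpos (sub_nonpos.2 (ht.monotone hk))
      (sub_nonpos.2 (ht.monotone (by omega)))
  · exact mul_nonneg (sub_nonneg.2 (ht.monotone hk.le)) (sub_nonneg.2 (ht.monotone (by omega)))

/-- The forms that decide the position of `X` relative to lines and planes through the points do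
not vanish. -/
structure IsGeneric {m : ℕ} (t : Fin m → ℝ) (X : Fin 3 → ℝ) : Prop where
  quad : ∀ i j, i < j → quadForm X (t i) (t j) ≠ 0
  cubic : ∀ i j k, i < j → j < k → cubicForm X (t i) (t j) (t k) ≠ 0

/-- The point `X` lies above a face: its projection is in the interior of the projected face. -/
structure IsAboveFace (H : SimpleGraph (Fin (n + 2))) (t : Fin (n + 2) → ℝ) (X : Fin 3 → ℝ)
    (x y z : Fin (n + 2)) : Prop where
  face : IsFace H x y z
  quad_xy : 0 < quadForm X (t x) (t y)
  quad_xz : quadForm X (t x) (t z) < 0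
  quad_yz : 0 < quadForm X (t y) (t z)
  cubic : 0 < cubicForm X (t x) (t y) (t z)

namespace IsConePersistent

variable {H : SimpleGraph (Fin (n + 2))} {t : Fin (n + 2) → ℝ} {X : Fin 3 → ℝ}

/-- The climb starts on the lower boundary of the polytope, formed by the triangles 0, i, i + 1. The
first sign change of the form of 0j picks the one below `X`; consecutive labels leave no room for a
crossing edge. -/
theorem exists_isAboveFace (hH : IsConePersistent H) (ht : StrictMono t)
    (hX : X ∈ cyclicPolytope3 t) (hgen : IsGeneric t X) : ∃ x y z, IsAboveFace H t X x y z := by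
  obtain ⟨lam, hl⟩ := mem_momentHull_iff.1 hX
  have hlast : quadForm X (t 0) (t (Fin.last (n + 1))) ≤ 0 := hl.quadForm_nonpos fun i _ =>
    mul_nonpos_of_nonneg_of_nonpos (sub_nonneg.2 (ht.monotone (Fin.zero_le i)))
      (sub_nonpos.2 (ht.monotone (Fin.le_last i)))
  obtain ⟨j, ⟨hj0, hj⟩, hmin⟩ := exists_least_of_exists
    (P := fun j => 0 < j ∧ quadForm X (t 0) (t j) ≤ 0) ⟨_, Fin.last_pos, hlast⟩
  have hj0' : 0 < (j : ℕ) := hj0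
  obtain ⟨i, hi⟩ : ∃ i : Fin (n + 2), (i : ℕ) + 1 = j := ⟨⟨j - 1, by omega⟩, by simp; omega⟩
  have hij : i < j := by omega
  have hi0 : 0 < i := by
    refine Fin.pos_iff_ne_zero.2 fun h => ?_
    subst h
    exact hgen.quad 0 j hj0 (le_antisymm hj (hl.quadForm_succ_nonneg ht hi))
  have hqi : 0 < quadForm X (t 0) (t i) := not_le.1 fun h => hmin i hij ⟨hi0, h⟩
  have hc : 0 ≤ cubicForm X (t 0) (t i) (t j) := hl.cubicForm_nonneg fun k _ => by
    rw [mul_assoc]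
    refine mul_nonneg (sub_nonneg.2 (ht.monotone (Fin.zero_le k))) ?_
    rcases le_or_gt k i with hk | hk
    · exact mul_nonneg_of_nonpos_of_nonpos (sub_nonpos.2 (ht.monotone hk))
        (sub_nonpos.2 (ht.monotone (by omega)))
    · exact mul_nonneg (sub_nonneg.2 (ht.monotone hk.le)) (sub_nonneg.2 (ht.monotone (by omega)))
  exact ⟨0, i, j, ⟨hi0, hij, hH.adj_zero i hi0, hH.hamilton i j hi, hH.adj_zero j hj0,
    fun b d _ _ h3 h4 => by omega⟩, hqi, lt_of_le_of_ne hj (hgen.quad 0 j hj0),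
    lt_of_le_of_ne (hl.quadForm_succ_nonneg ht hi) (hgen.quad i j hij).symm,
    lt_of_le_of_ne hc (hgen.cubic 0 i j hi0 hij).symm⟩

/-- Among the faces below `X`, one of least height cannot be left upwards, so the tetrahedron above
it contains `X`. It is no upper facet of the polytope, since no point of the polytope lies above
one. -/
theorem exists_isXi_mem_of_isGeneric (hH : IsConePersistent H) (ht : StrictMono t)
    (hX : X ∈ cyclicPolytope3 t) (hgen : IsGeneric t X) :
    ∃ l v w r, IsXi H l v w r ∧
      X ∈ momentHull t (({l, v, w, r} : Finset (Fin (n + 2))) : Set (Fin (n + 2))) := by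
  obtain ⟨x₀, y₀, z₀, h₀⟩ := hH.exists_isAboveFace ht hX hgen
  obtain ⟨⟨x, y, z⟩, h, hmin⟩ := Set.exists_min_image
    {p : Fin (n + 2) × Fin (n + 2) × Fin (n + 2) | IsAboveFace H t X p.1 p.2.1 p.2.2}
    (fun p => cubicForm X (t p.1) (t p.2.1) (t p.2.2)) (Set.toFinite _) ⟨(x₀, y₀, z₀), h₀⟩
  replace h : IsAboveFace H t X x y z := h
  replace hmin : ∀ a b c, IsAboveFace H t X a b c →
      ¬ cubicForm X (t a) (t b) (t c) < cubicForm X (t x) (t y) (t z) :=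
    fun a b c habc => not_lt.2 (hmin (a, b, c) habc)
  have hxy := ht h.face.xy
  have hyz := ht h.face.yz
  rcases hH.exists_isXi_above h.face with ⟨hsucc, rfl⟩ | ⟨u, hu⟩ | ⟨u, hu⟩
  · obtain ⟨lam, hl⟩ := mem_momentHull_iff.1 hX
    have hle : cubicForm X (t x) (t y) (t (Fin.last (n + 1))) ≤ 0 := hl.cubicForm_nonpos fun k _ =>
      mul_nonpos_of_nonneg_of_nonpos (by
        rcases le_or_gt k x with hk | hk
        · exact mul_nonneg_of_nonpos_of_nonpos (sub_nonpos.2 (ht.monotone hk))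
            (sub_nonpos.2 (ht.monotone (by omega)))
        · exact mul_nonneg (sub_nonneg.2 (ht.monotone hk.le))
            (sub_nonneg.2 (ht.monotone (by omega)))) (sub_nonpos.2 (ht.monotone (Fin.le_last k)))
    exact absurd h.cubic hle.not_gt
  · rcases climb_last hxy hyz (ht hu.wr) h.quad_xy h.quad_xz h.quad_yz h.cubic
      (hgen.quad y u (hu.vw.trans hu.wr)) with ⟨h1, h2, h3⟩ | ⟨h1, h2, h3, h4⟩ | ⟨h1, h2, h3, h4⟩
    · exact ⟨x, y, z, u, hu, mem_momentHull_of_cubicForm ht hu.lv hu.vw hu.wr h.cubic.le h1 h2 h3⟩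
    · exact absurd h2 (hmin x y u ⟨hH.isFace_of_isXi_lvr hu, h.quad_xy, h3, h4, h1⟩)
    · exact absurd h2 (hmin y z u ⟨hH.isFace_of_isXi_vwr hu, h.quad_yz, h3, h4, h1⟩)
  · rcases climb_middle (ht hu.lv) (ht hu.vw) hyz h.quad_xy h.quad_xz h.quad_yz h.cubic
      (hgen.quad u z (hu.vw.trans hu.wr)) with ⟨h1, h2, h3⟩ | ⟨h1, h2, h3, h4⟩ | ⟨h1, h2, h3, h4⟩
    · exact ⟨x, u, y, z, hu, mem_momentHull_of_cubicForm ht hu.lv hu.vw hu.wr h1 h.cubic.le h2 h3⟩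
    · exact absurd h2 (hmin x u z ⟨hH.isFace_of_isXi_lvr hu, h3, h.quad_xz, h4, h1⟩)
    · exact absurd h2 (hmin u y z ⟨hH.isFace_of_isXi_vwr hu, h3, h4, h.quad_yz, h1⟩)

end IsConePersistent

/-! ### Approximation by generic points -/

/-- This is a polynomial in ε with constant coefficient `c` and further coefficients `f i - c`. They
cannot all vanish, so there are no roots just to the right of 0. -/
theorem eventually_perturbation_ne_zero {m : ℕ} (f : Fin m → ℝ) (hf : ∃ i, f i ≠ 0) (c : ℝ) :
    ∀ᶠ ε in 𝓝[>] (0 : ℝ),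
      (1 - ∑ i : Fin m, ε ^ ((i : ℕ) + 1)) * c + ∑ i : Fin m, ε ^ ((i : ℕ) + 1) * f i ≠ 0 := by
  obtain ⟨i, hi⟩ := hf
  set P : Polynomial ℝ := Polynomial.C c +
    ∑ i : Fin m, Polynomial.C (f i - c) * Polynomial.X ^ ((i : ℕ) + 1) with hP
  have hcoeff : ∀ k : Fin m, P.coeff (k + 1) = f k - c := by
    intro k
    have hinj : ∀ b : Fin m, (k : ℕ) = b ↔ k = b := fun b => Fin.val_inj
    simp only [hP, Polynomial.coeff_add, Polynomial.finsetSum_coeff, Polynomial.coeff_C_mul,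
      Polynomial.coeff_X_pow, Polynomial.coeff_C_succ, add_left_inj, hinj, mul_ite, mul_one,
      mul_zero, Finset.sum_ite_eq, Finset.mem_univ, if_true, zero_add]
  have hzero : P.coeff 0 = c := by
    simp only [hP, Polynomial.coeff_add, Polynomial.finsetSum_coeff, Polynomial.coeff_C_mul,
      Polynomial.coeff_X_pow, Polynomial.coeff_C_zero]
    simp
  have hP0 : P ≠ 0 := by
    intro h
    have h1 := hcoeff i
    rw [← hzero, h] at h1
    simp at h1
    exact hi h1.symm
  have heval : ∀ ε, P.eval ε =
      (1 - ∑ i : Fin m, ε ^ ((i : ℕ) + 1)) * c + ∑ i : Fin m, ε ^ ((i : ℕ) + 1) * f i := by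
    intro ε
    have : ∀ i : Fin m, (f i - c) * ε ^ ((i : ℕ) + 1) =
        ε ^ ((i : ℕ) + 1) * f i - ε ^ ((i : ℕ) + 1) * c := fun i => by ring
    simp only [hP, Polynomial.eval_add, Polynomial.eval_C, Polynomial.eval_finsetSum,
      Polynomial.eval_mul, Polynomial.eval_pow, Polynomial.eval_X, this, Finset.sum_sub_distrib,
      ← Finset.sum_mul]
    ring
  have hfin : ({ε | P.IsRoot ε} \ {0}).Finite := (Polynomial.finite_setOfPred_isRoot hP0).sdiff
  have hnhds : ({ε | P.IsRoot ε} \ {0})ᶜ ∈ 𝓝 (0 : ℝ) :=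
    hfin.isClosed.isOpen_compl.mem_nhds (by simp)
  filter_upwards [nhdsWithin_le_nhds hnhds, self_mem_nhdsWithin] with ε h1 h2 h3
  exact h1 ⟨(heval ε).trans h3, (Set.mem_Ioi.1 h2).ne'⟩

/-- Points of the polytope are limits of generic ones. -/
theorem exists_tendsto_isGeneric {t : Fin (n + 2) → ℝ} (hn : 2 ≤ n) (ht : StrictMono t)
    {X : Fin 3 → ℝ} (hX : X ∈ cyclicPolytope3 t) :
    ∃ q : ℝ → Fin 3 → ℝ, Tendsto q (𝓝[>] 0) (𝓝 X) ∧
      ∀ᶠ ε in 𝓝[>] (0 : ℝ), q ε ∈ cyclicPolytope3 t ∧ IsGeneric t (q ε) := by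
  obtain ⟨lam, hl⟩ := mem_momentHull_iff.1 hX
  set s : ℝ → ℝ := fun ε => ∑ i : Fin (n + 2), ε ^ ((i : ℕ) + 1) with hs
  -- Distinct powers of ε keep the contributions of the labels from cancelling identically in any
  -- form.
  set mu : ℝ → Fin (n + 2) → ℝ := fun ε i => (1 - s ε) * lam i + ε ^ ((i : ℕ) + 1) with hmu
  set q : ℝ → Fin 3 → ℝ := fun ε k => ∑ i, mu ε i * t i ^ ((k : ℕ) + 1) with hq
  have hscont : Continuous s := by fun_prop
  have hs0 : s 0 = 0 := by simp [hs]
  have hqcont : Continuous q := by fun_prop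
  have hq0 : q 0 = X := by
    funext k
    simp [hq, hmu, hs0, hl.moment k]
  have hmem : ∀ᶠ ε in 𝓝[>] (0 : ℝ), IsMomentWeight t Set.univ (q ε) (mu ε) := by
    have h1 : ∀ᶠ ε in 𝓝[>] (0 : ℝ), s ε < 1 :=
      nhdsWithin_le_nhds (hscont.continuousAt.eventually_lt continuousAt_const (by simp [hs0]))
    filter_upwards [h1, self_mem_nhdsWithin] with ε h2 h3
    refine ⟨fun i => ?_, fun i hi => absurd (Set.mem_univ i) hi, ?_, fun k => rfl⟩
    · exact add_nonneg (mul_nonneg (by linarith) (hl.nonneg i)) (pow_nonneg (Set.mem_Ioi.1 h3).le _)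
    · simp only [hmu, Finset.sum_add_distrib, ← Finset.mul_sum, hl.sum_one]
      simp only [hs]
      ring
  have hsum : ∀ (ε : ℝ) (f : Fin (n + 2) → ℝ), ∑ i, mu ε i * f i =
      (1 - s ε) * ∑ i, lam i * f i + ∑ i : Fin (n + 2), ε ^ ((i : ℕ) + 1) * f i := by
    intro ε f
    simp only [hmu, add_mul, Finset.sum_add_distrib, Finset.mul_sum, mul_assoc]
  -- Here 2 ≤ n matters: a fourth label is needed at which the cubic polynomial does not vanish.
  have hother : ∀ i j k : Fin (n + 2), ∃ l, t l - t i ≠ 0 ∧ t l - t j ≠ 0 ∧ t l - t k ≠ 0 := by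
    intro i j k
    obtain ⟨l, hl⟩ : ∃ l, l ∉ ({i, j, k} : Finset (Fin (n + 2))) := by
      by_contra! hcon
      have h1 := Finset.card_le_card (fun l _ => hcon l : Finset.univ ⊆ {i, j, k})
      have h2 := Finset.card_le_three (a := i) (b := j) (c := k)
      rw [Finset.card_univ, Fintype.card_fin] at h1
      omega
    simp only [Finset.mem_insert, Finset.mem_singleton, not_or] at hl
    exact ⟨l, sub_ne_zero.2 (ht.injective.ne hl.1), sub_ne_zero.2 (ht.injective.ne hl.2.1),
      sub_ne_zero.2 (ht.injective.ne hl.2.2)⟩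
  have hquad : ∀ᶠ ε in 𝓝[>] (0 : ℝ), ∀ i j, quadForm (q ε) (t i) (t j) ≠ 0 := by
    simp only [eventually_all]
    intro i j
    obtain ⟨l, h1, h2, -⟩ := hother i j j
    filter_upwards [hmem, eventually_perturbation_ne_zero
      (fun l => (t l - t i) * (t l - t j)) ⟨l, mul_ne_zero h1 h2⟩
      (∑ k, lam k * ((t k - t i) * (t k - t j)))] with ε h3 h4
    rwa [← h3.sum_quad, hsum]
  have hcubic : ∀ᶠ ε in 𝓝[>] (0 : ℝ), ∀ i j k, cubicForm (q ε) (t i) (t j) (t k) ≠ 0 := by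
    simp only [eventually_all]
    intro i j k
    obtain ⟨l, h1, h2, h5⟩ := hother i j k
    filter_upwards [hmem, eventually_perturbation_ne_zero
      (fun l => (t l - t i) * (t l - t j) * (t l - t k)) ⟨l, mul_ne_zero (mul_ne_zero h1 h2) h5⟩
      (∑ l, lam l * ((t l - t i) * (t l - t j) * (t l - t k)))] with ε h3 h4
    rwa [← h3.sum_cubic, hsum]
  refine ⟨q, ?_, ?_⟩
  · rw [← hq0]
    exact (hqcont.tendsto 0).mono_left nhdsWithin_le_nhds
  · filter_upwards [hmem, hquad, hcubic] with ε h1 h2 h3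
    exact ⟨mem_momentHull_iff.2 ⟨_, h1⟩, fun i j _ => h2 i j, fun i j k _ _ => h3 i j k⟩

/-! ### Γ and Ξ are well defined and mutually inverse -/

theorem momentHull_subset_cyclicPolytope3 {m : ℕ} (t : Fin m → ℝ) (S : Set (Fin m)) :
    momentHull t S ⊆ cyclicPolytope3 t :=
  momentHull_mono t (Set.subset_univ S)

theorem IsXi.card_eq {H : SimpleGraph (Fin (n + 2))} {l v w r : Fin (n + 2)}
    (h : IsXi H l v w r) : ({l, v, w, r} : Finset (Fin (n + 2))).card = 4 := by
  have h1 := h.lv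
  have h2 := h.vw
  have h3 := h.wr
  rw [Finset.card_insert_of_notMem, Finset.card_insert_of_notMem, Finset.card_insert_of_notMem,
    Finset.card_singleton] <;>
  simp only [Finset.mem_insert, Finset.mem_singleton, not_or] <;> omega

theorem IsConePersistent.adj_of_mem {H : SimpleGraph (Fin (n + 2))} (hH : IsConePersistent H)
    {l v w r : Fin (n + 2)} (h : IsXi H l v w r) {x y : Fin (n + 2)} (hxy : x ≠ y)
    (hx : x ∈ ({l, v, w, r} : Finset (Fin (n + 2))))
    (hy : y ∈ ({l, v, w, r} : Finset (Fin (n + 2)))) : H.Adj x y := by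
  have h1 := hH.adj_left h
  have h2 := hH.adj_right h
  have h3 := hH.adj_outer h
  have h4 := h.adj_vw
  have h5 := h.adj_lw
  have h6 := h.adj_vr
  simp only [Finset.mem_insert, Finset.mem_singleton] at hx hy
  rcases hx with rfl | rfl | rfl | rfl <;> rcases hy with rfl | rfl | rfl | rfl <;>
    first
    | exact absurd rfl hxy
    | assumption
    | (apply SimpleGraph.Adj.symm; assumption)

theorem isCyclicTriangulation_XiMap {t : Fin (n + 2) → ℝ} (hn : 2 ≤ n) (ht : StrictMono t)
    {G : SimpleGraph (Fin n)} (hG : IsPersistent G) : IsCyclicTriangulation t (XiMap G) := by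
  have hH := hG.hatGraph
  have hcross : ∀ S ∈ XiMap G, ∀ S' ∈ XiMap G, ¬ Crosses S S' := by
    rintro S hS S' hS' ⟨a, b, c, d, e, hab, hbc, hcd, hde, ha, hc, he, hb, hd⟩
    obtain ⟨l, v, w, r, h, rfl⟩ := (mem_XiMap_iff G).1 hS
    obtain ⟨l', v', w', r', h', rfl⟩ := (mem_XiMap_iff G).1 hS'
    exact hH.not_adj_of_crossed h (by simpa using ha) (by simpa using hc) (by simpa using he) hab
      hbc hcd hde (hH.adj_of_mem h' (hbc.trans hcd).ne hb hd)
  refine ⟨?_, ?_, fun S hS S' hS' =>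
    momentHull_inter_of_not_crosses ht (hcross S hS S' hS') (hcross S' hS' S hS)⟩
  · intro S hS
    obtain ⟨l, v, w, r, h, rfl⟩ := (mem_XiMap_iff G).1 hS
    exact h.card_eq
  · refine Set.Subset.antisymm
      (Set.iUnion₂_subset fun S _ => momentHull_subset_cyclicPolytope3 t _) fun X hX => ?_
    obtain ⟨q, hq, hev⟩ := exists_tendsto_isGeneric hn ht hX
    have hclosed : IsClosed (⋃ S ∈ XiMap G, momentHull t (S : Set (Fin (n + 2)))) :=
      (Set.toFinite _).isClosed_biUnion fun S _ => isClosed_momentHull t _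
    refine hclosed.mem_of_tendsto hq ?_
    filter_upwards [hev] with ε hε
    obtain ⟨l, v, w, r, h, hmem⟩ := hH.exists_isXi_mem_of_isGeneric ht hε.1 hε.2
    exact Set.mem_biUnion ((mem_XiMap_iff G).2 ⟨l, v, w, r, h, rfl⟩) hmem

theorem GammaMap_XiMap {G : SimpleGraph (Fin n)} (hG : IsPersistent G) :
    GammaMap (XiMap G) = G := by
  have hH := hG.hatGraph
  ext i j
  constructor
  · rintro ⟨hne, S, hS, hi, hj⟩
    obtain ⟨l, v, w, r, h, rfl⟩ := (mem_XiMap_iff G).1 hS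
    exact (hatGraph_adj_innerVertex G).1 (hH.adj_of_mem h (innerVertex_injective.ne hne) hi hj)
  · intro hij
    have key : ∀ i j : Fin n, i < j → G.Adj i j → (GammaMap (XiMap G)).Adj i j := by
      intro i j hlt hij
      refine ⟨hij.ne, xiSimplex G i j, ⟨i, j, hlt, hij, rfl⟩, ?_, ?_⟩ <;> simp [xiSimplex]
    rcases lt_or_gt_of_ne hij.ne with h | h
    · exact key i j h hij
    · exact (key j i h hij.symm).symm

theorem isPersistent_GammaMap {t : Fin (n + 2) → ℝ} (ht : StrictMono t)
    {T : Set (Finset (Fin (n + 2)))} (hT : IsCyclicTriangulation t T) :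
    IsPersistent (GammaMap T) where
  hamilton i j hij := by
    obtain ⟨S, hS, hi, hj⟩ := hT.exists_mem_of_succ ht (i := innerVertex i) (j := innerVertex j)
      (by simpa using hij)
    exact ⟨by omega, S, hS, hi, hj⟩
  xProperty a b c d hab hbc hcd := by
    rintro ⟨_, S, hS, ha, hc⟩ ⟨_, S', hS', hb, hd⟩
    obtain ⟨R, hR, ha', hd'⟩ := hT.exists_mem_of_crossing ht (innerVertex_lt_iff.2 hab)
      (innerVertex_lt_iff.2 hbc) (innerVertex_lt_iff.2 hcd) hS hS' ha hc hb hd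
    exact ⟨(hab.trans (hbc.trans hcd)).ne, R, hR, ha', hd'⟩
  barProperty a b := by
    rintro ⟨_, S, hS, ha, hb⟩ hlt
    obtain ⟨y, hay, hyb, R, hR, ha', hy', hb'⟩ := hT.exists_mem_between ht hS
      (x := innerVertex ⟨a + 1, by omega⟩) (innerVertex_lt_iff.2 (by rw [Fin.lt_def]; simp))
      (innerVertex_lt_iff.2 (by rw [Fin.lt_def]; simpa using hlt)) ha hb
    obtain ⟨y, rfl⟩ := exists_innerVertex_eq hay hyb
    rw [innerVertex_lt_iff] at hay hyb
    exact ⟨y, hay, hyb, ⟨hay.ne, R, hR, ha', hy'⟩, hyb.ne, R, hR, hy', hb'⟩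

theorem exists_eq_of_card_eq_four {m : ℕ} {S : Finset (Fin m)} (hS : S.card = 4) :
    ∃ a b c d, a < b ∧ b < c ∧ c < d ∧ S = {a, b, c, d} := by
  have hmono := (S.orderEmbOfFin hS).strictMono
  refine ⟨S.orderEmbOfFin hS 0, S.orderEmbOfFin hS 1, S.orderEmbOfFin hS 2, S.orderEmbOfFin hS 3,
    hmono (by decide), hmono (by decide), hmono (by decide), ?_⟩
  ext i
  have hrange : i ∈ S ↔ ∃ k, S.orderEmbOfFin hS k = i := by
    rw [← Finset.mem_coe, ← Finset.range_orderEmbOfFin S hS, Set.mem_range]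
  rw [hrange]
  simp [Fin.exists_fin_succ, eq_comm]

/-- The bounds only certify that `x` and `y` are inner vertices, where adjacency in the cone comes
from a tetrahedron. -/
theorem exists_mem_of_hatGraph_GammaMap_adj {T : Set (Finset (Fin (n + 2)))}
    {x y a b c d : Fin (n + 2)} (hax : a < x) (hxb : x < b) (hcy : c < y) (hyd : y < d)
    (h : (hatGraph (GammaMap T)).Adj x y) : ∃ S ∈ T, x ∈ S ∧ y ∈ S := by
  obtain ⟨i, rfl⟩ := exists_innerVertex_eq hax hxb
  obtain ⟨j, rfl⟩ := exists_innerVertex_eq hcy hyd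
  exact ((hatGraph_adj_innerVertex _).1 h).2

theorem hatGraph_GammaMap_adj {T : Set (Finset (Fin (n + 2)))} {S : Finset (Fin (n + 2))}
    (hS : S ∈ T) {x y : Fin (n + 2)} (hx : x ∈ S) (hy : y ∈ S) (hxy : x < y) :
    (hatGraph (GammaMap T)).Adj x y := by
  rcases eq_or_ne x 0 with rfl | hx0
  · exact hatGraph_zero_adj _ hxy
  rcases eq_or_ne y (Fin.last (n + 1)) with rfl | hy0
  · exact hatGraph_adj_last' _ hxy
  obtain ⟨i, rfl⟩ := exists_innerVertex_eq (Fin.pos_iff_ne_zero.2 hx0) hxy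
  obtain ⟨j, rfl⟩ := exists_innerVertex_eq hxy (Fin.lt_last_iff_ne_last.2 hy0)
  exact (hatGraph_adj_innerVertex _).2 ⟨fun h => hxy.ne (congrArg _ h), S, hS, hx, hy⟩

/-- A neighbour i of `w` between `l` and `v` gives an edge iw piercing the triangle lvr; a neighbour
i of `v` between `w` and `r` gives an edge vi piercing lwr. -/
theorem IsCyclicTriangulation.isXi_of_mem {t : Fin (n + 2) → ℝ} (ht : StrictMono t)
    {T : Set (Finset (Fin (n + 2)))} (hT : IsCyclicTriangulation t T) {l v w r : Fin (n + 2)}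
    (hlv : l < v) (hvw : v < w) (hwr : w < r)
    (hS : ({l, v, w, r} : Finset (Fin (n + 2))) ∈ T) : IsXi (hatGraph (GammaMap T)) l v w r := by
  refine ⟨hlv, hvw, hwr, hatGraph_GammaMap_adj hS (by simp) (by simp) hvw,
    hatGraph_GammaMap_adj hS (by simp) (by simp) (hlv.trans hvw),
    hatGraph_GammaMap_adj hS (by simp) (by simp) (hvw.trans hwr), fun i hli hiv h => ?_,
    fun i hwi hir h => ?_⟩
  · obtain ⟨S', hS', hi, hw⟩ := exists_mem_of_hatGraph_GammaMap_adj hli hiv hvw hwr h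
    exact hT.not_crosses ht hS hS' ⟨l, i, v, w, r, hli, hiv, hvw, hwr, by simp, by simp, by simp,
      hi, hw⟩
  · obtain ⟨S', hS', hv, hi⟩ := exists_mem_of_hatGraph_GammaMap_adj hlv hvw hwi hir h
    exact hT.not_crosses ht hS hS' ⟨l, v, w, i, r, hlv, hvw, hwi, hir, by simp, by simp, by simp,
      hv, hi⟩

theorem XiMap_GammaMap {t : Fin (n + 2) → ℝ} (ht : StrictMono t)
    {T : Set (Finset (Fin (n + 2)))} (hT : IsCyclicTriangulation t T) :
    XiMap (GammaMap T) = T := by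
  ext S
  rw [mem_XiMap_iff]
  constructor
  · rintro ⟨l, v, w, r, h, rfl⟩
    obtain ⟨S₀, hS₀, hv₀, hw₀⟩ :=
      exists_mem_of_hatGraph_GammaMap_adj h.lv h.vw h.vw h.wr h.adj_vw
    -- The triangulation has some tetrahedron with middle edge vw. It too is the one assigned to vw,
    -- so its outer vertices agree with `l` and `r`.
    obtain ⟨S, hS, hv, hw, ⟨x, hxS, hxv⟩, y, hyS, hwy⟩ :=
      hT.exists_middle_edge ht hS₀ h.lv h.vw h.wr hv₀ hw₀
    have hsub : ({x, v, w, y} : Finset (Fin (n + 2))) ⊆ S := by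
      intro i hi
      simp only [Finset.mem_insert, Finset.mem_singleton] at hi
      rcases hi with rfl | rfl | rfl | rfl <;> assumption
    have hcard : ({x, v, w, y} : Finset (Fin (n + 2))).card = 4 := by
      have := h.vw
      rw [Finset.card_insert_of_notMem, Finset.card_insert_of_notMem,
        Finset.card_insert_of_notMem, Finset.card_singleton] <;>
      simp only [Finset.mem_insert, Finset.mem_singleton, not_or] <;> omega
    have heq := Finset.eq_of_subset_of_card_le hsub (by rw [hcard, hT.card_eq S hS])
    subst heq
    have h' := hT.isXi_of_mem ht hxv h.vw hwy hS
    obtain rfl : l = x := by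
      rcases lt_trichotomy l x with h1 | h1 | h1
      · exact absurd h'.adj_lw (h.left_max x h1 hxv)
      · exact h1
      · exact absurd h.adj_lw (h'.left_max l h1 h.lv)
    obtain rfl : r = y := by
      rcases lt_trichotomy r y with h1 | h1 | h1
      · exact absurd h.adj_vr (h'.right_min r h.wr h1)
      · exact h1
      · exact absurd h'.adj_vr (h.right_min y hwy h1)
    exact hS
  · intro hS
    obtain ⟨a, b, c, d, hab, hbc, hcd, rfl⟩ := exists_eq_of_card_eq_four (hT.card_eq S hS)
    exact ⟨a, b, c, d, hT.isXi_of_mem ht hab hbc hcd hS, rfl⟩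

theorem theorem2p6 (n : ℕ) (hn : 2 ≤ n) (t : Fin (n + 2) → ℝ) (ht : StrictMono t) :
    Set.MapsTo (GammaMap (n := n)) (cyclicTriangulations t) (persistentGraphs n) ∧
    Set.MapsTo (XiMap (n := n)) (persistentGraphs n) (cyclicTriangulations t) ∧
    (∀ T ∈ cyclicTriangulations t, XiMap (GammaMap T) = T) ∧
    (∀ G ∈ persistentGraphs n, GammaMap (XiMap G) = G) ∧
    Set.BijOn (GammaMap (n := n)) (cyclicTriangulations t) (persistentGraphs n) ∧
    Set.BijOn (XiMap (n := n)) (persistentGraphs n) (cyclicTriangulations t) := by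
  have h1 : Set.MapsTo (GammaMap (n := n)) (cyclicTriangulations t) (persistentGraphs n) :=
    fun _ hT => isPersistent_GammaMap ht hT
  have h2 : Set.MapsTo (XiMap (n := n)) (persistentGraphs n) (cyclicTriangulations t) :=
    fun _ hG => isCyclicTriangulation_XiMap hn ht hG
  have h3 : ∀ T ∈ cyclicTriangulations t, XiMap (GammaMap T) = T :=
    fun _ hT => XiMap_GammaMap ht hT
  have h4 : ∀ G ∈ persistentGraphs n, GammaMap (XiMap G) = G := fun _ hG => GammaMap_XiMap hG
  have hinv : Set.InvOn (XiMap (n := n)) (GammaMap (n := n)) (cyclicTriangulations t)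
      (persistentGraphs n) := ⟨h3, h4⟩
  exact ⟨h1, h2, h3, h4, hinv.bijOn h1 h2, hinv.symm.bijOn h2 h1⟩
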